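/- **Setting.** Let $\lambda$ be the security parameter. PPT means probabilistic polynomial time; a function of $\lambda$ is negligible if it decays faster than the inverse of every polynomial. Let $H^s:\{0,1\}^*\to\{0,1\}^{n(\lambda)}$ be a family of polynomial-time hash functions whose public key $s$ is generated by a PPT algorithm; $\|$ denotes an unambiguous encoding of concatenation. *Execution.* There are polynomial-time computable (possibly depending on $\lambda,s$) maps: a genesis state $st_0$, a transition function $\delta(st,tx)$, a commitment $\langle st\rangle$, and a succinct transition function $\langle\delta\rangle(c,tx,\pi)$ which returns a commitment or an error. States $\delta^*(st_0,L)=\delta(\cdots\delta(st_0,tx_1)\cdots,tx_m)$ have size polynomial in $\lambda$, $|s|$ and the size of $L=(tx_1,\dots,tx_m)$. The execution oracle, asked about $(c,tx,c')$, accepts a proof $\pi$ iff $\langle\delta\rangle(c,tx,\pi)=c'$. It is *complete* if there is a PPT machine $M$ such that $\langle\delta\rangle(\langle st\rangle,tx,M(st,tx))=\langle\delta(st,tx)\rangle$ always, and *sound* if no PPT adversary finds, except with negligible probability, $(st,tx,\pi)$ such that $\langle\delta\rangle(\langle st\rangle,tx,\pi)$ is a commitment different from $\langle\delta(st,tx)\rangle$.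 *Consensus.* In an execution of a consensus protocol by polynomial-time parties, every honest full node $P$ holds at each round $r$ a dirty ledger $L^P_r$, a finite sequence of transactions, which the adversary can read, together with all other information public at round $r$. The ledger is safe: $L^{P_1}_{r_1}$ is a prefix of $L^{P_2}_{r_2}$ for honest $P_1,P_2$ and $r_1<r_2$. No transaction occurs twice on a ledger, and the empty string $\epsilon$ is not a transaction on it. Let $L^\cup_r$ be the longest honest ledger at round $r$. We say that $tx'$ follows $tx$ on a ledger $L$ if $tx,tx'$ are consecutive in the sequence $(\epsilon,L)$. The consensus oracle is a black box returning bits $CO_r(tx,tx')$. It is *complete* if $CO_r(tx,tx')$ is true whenever $tx'$ follows $tx$ on $L^\cup_r$, and *sound with delay $\nu$* if every PPT adversary that chooses a round $r$, and then, from the public information at round $r$, two transactions $tx,tx'$, achieves only with negligible probability that $CO_r(tx,tx')$ is true and $tx'$ does not follow $tx$ on $L^\cup_{r+\nu}$. *Commitments to ledgers.* The augmented dirty ledger of $L=(tx_1,\dots,tx_m)$ is $L_+=((\epsilon,\langle st_0\rangle),(tx_1,\langle\delta^*(st_0,(tx_1))\rangle),\dots,(tx_m,\langle\delta^*(st_0,L)\rangle))$.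 A Merkle tree over $2^q$ entries has leaf hashes $H^s(\text{entry})$ and inner nodes $H^s(h_l\|h_r)$. The Merkle mountain range (MMR) of a sequence of $\ell$ entries splits it into consecutive segments of strictly decreasing power-of-two lengths and forms the Merkle tree of each; their roots are the peaks. **Challenge game** (played at a round $r$, with constants $\alpha,u,\nu\in\mathbb N$). The honest challenger is an honest full node $P$; $L_+$ is the augmented dirty ledger of $L^P_r$, of size $\ell$. The responder claims a size $\ell^*\ge1$, one peak for each binary digit $1$ of $\ell^*$, and a last entry with a Merkle proof with respect to the last peak. The game is played if this proof is valid, $\ell^*\le\ell$, and the responder's peaks and size are not identical to the challenger's. 1. *Zooming.* The challenger goes through the responder's peaks in order, and compares each with the corresponding peak of his own MMR while the sizes agree. If he meets a peak of the same size but with a different root, he starts the bisection game on these two trees. At the first peak of a smaller size, all remaining peaks of the responder lie under his current tree; he descends in it. At a node he moves to the left child if it has more leaves than all remaining responder peaks together; otherwise he compares the left child with the first remaining responder peak, moves to the right child (dropping that peak) if the two hashes are equal, and starts the bisection game on the left child and that peak if they differ. If the responder's peaks are exhausted, he starts the suffix monologue. 2. *Bisection game*, on trees of height $q$. In each of $q$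 rounds the responder must open the current node into $h^*_l,h^*_r$ whose hash $H^s(h^*_l\|h^*_r)$ is that node; the challenger goes left if $h^*_l$ differs from his own left child and right otherwise. At the leaf, with index $j$ in the whole ledger, the responder must reveal an entry $(tx^*_j,c^*_j)$ with the correct leaf hash. If $j=0$, it must be $(\epsilon,\langle st_0\rangle)$. If $j\ge1$, the responder must reveal also an entry $(tx^*_{j-1},c^*_{j-1})$ with a Merkle proof with respect to the claimed peak above index $j-1$, and a proof $\pi$, such that $CO_r(tx^*_{j-1},tx^*_j)$ is true and $\langle\delta\rangle(c^*_{j-1},tx^*_j,\pi)=c^*_j$. The challenger wins if any check fails or the responder does not give a syntactically valid answer in time; otherwise the responder wins. 3. *Suffix monologue.* The challenger presents $L_+[\ell^*:\min(\ell,\ell^*+\alpha(u+\nu))]$ with state transition proofs computed by $M$. The verifier checks, with $CO_r$ and $\langle\delta\rangle$, every transition between consecutive entries, beginning with the transition from the responder's claimed last entry. If a check fails, the responder wins. Otherwise the challenger is a winner (the only one if $\ell>\ell^*+\alpha(u+\nu)$, and jointly with the responder if not). **Theorem (Soundness).** Assume that $H^s$ is collision resistant (no PPT adversary, given a random key $s$,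 finds a collision except with negligible probability), that the ledger is safe and has no duplicate transactions, that the consensus oracle is complete and sound with delay $\nu$, and that the execution oracle is complete and sound. Then for every PPT adversarial responder $\mathcal A$ (which chooses the round $r$ and, having received the public information at round $r$, the honest opponent $P$, its claim and all its answers), the probability that the challenge game is played and the honest challenger is not among its winners is negligible in $\lambda$; that is, the honest challenger wins the challenge game against $\mathcal A$ with overwhelming probability in $\lambda$. -/

import Mathlib

namespace LightClient

/-! ## Machine model: programs on binary trees, with a step count -/

/-- The values on which programs compute. -/
inductive Tree where
  | nil : Tree
  | cons : Tree → Tree → Tree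

namespace Tree

/-- The number of nodes of a tree. -/
def size : Tree → ℕ
  | nil => 1
  | cons a b => a.size + b.size + 1

def head : Tree → Tree
  | nil => nil
  | cons a _ => a

def tail : Tree → Tree
  | nil => nil
  | cons _ b => b

open Classical in
/-- On a pair, `cons nil nil` (true) if the two components are equal and `nil` (false) if not. -/
noncomputable def equal : Tree → Tree
  | nil => nil
  | cons a b => if a = b then cons nil nil else nil

end Tree

/-- Programs. In tests, `nil` counts as false and every other tree as true. -/
inductive Prog where
  | nil : Prog
  | copy : Prog
  | head : Prog
  | tail : Prog
  | equal : Prog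
  | comp : Prog → Prog → Prog
  | pair : Prog → Prog → Prog
  | branch : Prog → Prog → Prog → Prog
  | loop : Prog → Prog → Prog

/-- `Run c x y t`: on input `x` the program `c` halts with output `y` after `t` steps. A basic
instruction costs the size of the value that it reads, `comp g f` runs `f` and then `g`, and
`loop c f` is "while `c(x)` do `x := f(x)`". -/
inductive Prog.Run : Prog → Tree → Tree → ℕ → Prop where
  | nil (x : Tree) : Run .nil x .nil 1
  | copy (x : Tree) : Run .copy x x x.size
  | head (x : Tree) : Run .head x x.head x.size
  | tail (x : Tree) : Run .tail x x.tail x.size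
  | equal (x : Tree) : Run .equal x x.equal (x.size + 2)
  | comp {f g : Prog} {x y z : Tree} {t t' : ℕ} :
      Run f x y t → Run g y z t' → Run (.comp g f) x z (t + t' + 1)
  | pair {f g : Prog} {x y z : Tree} {t t' : ℕ} :
      Run f x y t → Run g x z t' → Run (.pair f g) x (.cons y z) (t + t' + 1)
  | branch_true {c f g : Prog} {x y z : Tree} {t t' : ℕ} :
      Run c x y t → y ≠ .nil → Run f x z t' → Run (.branch c f g) x z (t + t' + 1)
  | branch_false {c f g : Prog} {x z : Tree} {t t' : ℕ} :
      Run c x .nil t → Run g x z t' → Run (.branch c f g) x z (t + t' + 1)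
  | loop_stop {c f : Prog} {x : Tree} {t : ℕ} :
      Run c x .nil t → Run (.loop c f) x x (t + x.size + 1)
  | loop_step {c f : Prog} {x y z w : Tree} {t t' t'' : ℕ} :
      Run c x y t → y ≠ .nil → Run f x z t' → Run (.loop c f) z w t'' →
      Run (.loop c f) x w (t + t' + t'' + 1)

/-- An injective encoding of the elements of a type as trees. -/
class Enc (α : Type) where
  enc : α → Tree
  enc_injective : Function.Injective enc


open Enc (enc enc_injective)

instance : Enc Bool where
  enc b := if b then .cons .nil .nil else .nil
  enc_injective := by
    intro a b h
    cases a <;> cases b <;> simp_all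

/-- Natural numbers are encoded in unary. -/
def encNat : ℕ → Tree
  | 0 => .nil
  | n + 1 => .cons .nil (encNat n)

instance : Enc ℕ where
  enc := encNat
  enc_injective := by
    intro a
    induction a with
    | zero => intro b h; cases b <;> simp_all [encNat]
    | succ a ih =>
      intro b h
      cases b with
      | zero => simp [encNat] at h
      | succ b =>
        simp only [encNat, Tree.cons.injEq, true_and] at h
        rw [ih h]

instance {α β : Type} [Enc α] [Enc β] : Enc (α × β) where
  enc x := .cons (enc x.1) (enc x.2)
  enc_injective := by
    rintro ⟨a, b⟩ ⟨a', b'⟩ h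
    simp only [Tree.cons.injEq] at h
    rw [enc_injective h.1, enc_injective h.2]

instance {α : Type} [Enc α] : Enc (Option α) where
  enc x := match x with
    | none => .nil
    | some a => .cons .nil (enc a)
  enc_injective := by
    intro a b h
    cases a <;> cases b <;> simp at h ⊢
    exact enc_injective h

def encList {α : Type} [Enc α] : List α → Tree
  | [] => .nil
  | a :: l => .cons (enc a) (encList l)

instance {α : Type} [Enc α] : Enc (List α) where
  enc := encList
  enc_injective := by
    intro a
    induction a with
    | nil => intro b h; cases b <;> simp_all [encList]
    | cons a l ih =>
      intro b h
      cases b with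
      | nil => simp [encList] at h
      | cons b l' =>
        simp only [encList, Tree.cons.injEq] at h
        rw [enc_injective h.1, ih h.2]

/-- `f` is computed by a program whose running time is bounded by a polynomial in the size of
the (encoded) input. -/
def PolyTime {α β : Type} [Enc α] [Enc β] (f : α → β) : Prop :=
  ∃ (c : Prog) (p : Polynomial ℕ), ∀ a : α, ∃ t : ℕ,
    t ≤ p.eval (enc a).size ∧ c.Run (enc a) (enc (f a)) t

/-! ## Strings, coins, probabilities

A probabilistic polynomial-time algorithm is a `PolyTime` function that takes, besides the
security parameter `k` (in unary) and its other inputs, a string of uniform coins whose length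
is a polynomial in `k`. -/

abbrev Bits := List Bool

/-- `n` coin tosses. -/
abbrev Coins (n : ℕ) := Fin n → Bool

/-- The probability of an event under the uniform distribution on a finite sample space. -/
noncomputable def prob {Ω : Type} [Fintype Ω] (E : Ω → Prop) : ℝ :=
  (Nat.card {x : Ω // E x} : ℝ) / (Fintype.card Ω : ℝ)

/-- `f` decays faster than the inverse of every polynomial. -/
def Negligible (f : ℕ → ℝ) : Prop :=
  Asymptotics.SuperpolynomialDecay Filter.atTop (fun k : ℕ => (k : ℝ)) f

/-- The probability `p k` is overwhelming in `k`. -/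
def Overwhelming (p : ℕ → ℝ) : Prop := Negligible fun k => 1 - p k

/-- `a ‖ b`, an unambiguous encoding of the concatenation of two strings: each bit of `a` is
preceded by the bit `true`, and the bit `false` separates it from `b`. -/
def concat : Bits → Bits → Bits
  | [], b => false :: b
  | x :: a, b => true :: x :: concat a b

/-! ## Keyed hash functions -/

abbrev Key := Bits

/-- A keyed family of hash functions `H^s : {0,1}* → {0,1}^(outLen k)`, with an efficient key
generator. The key `s` is public; it may carry other public parameters as well. -/
structure HashFamily where
  keyCoins : Polynomial ℕ
  gen : ℕ → Bits → Key
  hash : ℕ → Key → Bits → Bits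
  outLen : ℕ → ℕ
  length_hash : ∀ k s x, (hash k s x).length = outLen k
  gen_polyTime : PolyTime fun x : ℕ × Bits => gen x.1 x.2
  hash_polyTime : PolyTime fun x : ℕ × Key × Bits => hash x.1 x.2.1 x.2.2

/-- The coins of the key generator at security parameter `k`. -/
abbrev HashFamily.KeyCoins (𝓗 : HashFamily) (k : ℕ) := Coins (𝓗.keyCoins.eval k)

/-- The key generated from the coins `g`. -/
def HashFamily.key (𝓗 : HashFamily) (k : ℕ) (g : 𝓗.KeyCoins k) : Key := 𝓗.gen k (List.ofFn g)

/-- No PPT adversary finds a collision under a random key, except with negligible probability. -/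
def HashFamily.CollisionResistant (𝓗 : HashFamily) : Prop :=
  ∀ (q : Polynomial ℕ) (A : ℕ × Key × Bits → Bits × Bits), PolyTime A →
    Negligible fun k => prob fun ω : 𝓗.KeyCoins k × Coins (q.eval k) =>
      let s := 𝓗.key k ω.1
      let xy := A (k, s, List.ofFn ω.2)
      xy.1 ≠ xy.2 ∧ 𝓗.hash k s xy.1 = 𝓗.hash k s xy.2

/-! ## Execution layer -/

abbrev Tx := Bits
abbrev State := Bits
abbrev Commitment := Bits
/-- An entry of an augmented dirty ledger: a transaction and a state commitment. -/
abbrev Entry := Tx × Commitment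

/-- A transition function `δ` with genesis state, a commitment scheme, a succinct transition
function (with value `none` where it throws an error) and a proof-computing machine `prove`,
whose last argument is its random tape. Everything is efficiently computable, and the states
reached from the genesis state have polynomial size. -/
structure ExecutionLayer where
  genesis : ℕ → Key → State
  δ : ℕ → Key → State → Tx → State
  commit : ℕ → Key → State → Commitment
  succinct : ℕ → Key → Commitment → Tx → Bits → Option Commitment
  prove : ℕ → Key → State → Tx → Bits → Bits
  genesis_polyTime : PolyTime fun x : ℕ × Key => genesis x.1 x.2
  δ_polyTime : PolyTime fun x : ℕ × Key × State × Tx => δ x.1 x.2.1 x.2.2.1 x.2.2.2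
  commit_polyTime : PolyTime fun x : ℕ × Key × State => commit x.1 x.2.1 x.2.2
  succinct_polyTime : PolyTime fun x : ℕ × Key × Commitment × Tx × Bits =>
    succinct x.1 x.2.1 x.2.2.1 x.2.2.2.1 x.2.2.2.2
  prove_polyTime : PolyTime fun x : ℕ × Key × State × Tx × Bits =>
    prove x.1 x.2.1 x.2.2.1 x.2.2.2.1 x.2.2.2.2
  state_size : ∃ p : Polynomial ℕ, ∀ (k : ℕ) (s : Key) (txs : List Tx),
    (txs.foldl (δ k s) (genesis k s)).length ≤ p.eval (enc (k, s, txs)).size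

namespace ExecutionLayer

variable (X : ExecutionLayer) (𝓗 : HashFamily)

/-- `δ*(st₀, txs)`. -/
def run (k : ℕ) (s : Key) (txs : List Tx) : State := txs.foldl (X.δ k s) (X.genesis k s)

/-- The proofs of `prove` are always accepted by the succinct transition function. -/
def Complete : Prop :=
  ∀ (k : ℕ) (g : 𝓗.KeyCoins k) (st : State) (tx : Tx) (ρ : Bits),
    let s := 𝓗.key k g
    X.succinct k s (X.commit k s st) tx (X.prove k s st tx ρ) = some (X.commit k s (X.δ k s st tx))

/-- No PPT adversary finds a state, a transaction and a proof on which the succinct transition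
function outputs a commitment other than the one to the updated state. -/
def Sound : Prop :=
  ∀ (q : Polynomial ℕ) (A : ℕ × Key × Bits → State × Tx × Bits), PolyTime A →
    Negligible fun k => prob fun ω : 𝓗.KeyCoins k × Coins (q.eval k) =>
      let s := 𝓗.key k ω.1
      let a := A (k, s, List.ofFn ω.2)
      ∃ c, X.succinct k s (X.commit k s a.1) a.2.1 a.2.2 = some c ∧
        c ≠ X.commit k s (X.δ k s a.1 a.2.1)

/-- The augmented dirty ledger `((ε, ⟨st₀⟩), (tx₁, ⟨δ(st₀, tx₁)⟩), …)` of a dirty ledger. -/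
def augment (k : ℕ) (s : Key) (L : List Tx) : List Entry :=
  ([], X.commit k s (X.genesis k s)) ::
    (List.range L.length).map fun i => (L.getD i [], X.commit k s (X.run k s (L.take (i + 1))))

end ExecutionLayer

/-! ## Consensus layer -/

/-- An execution of a consensus protocol, run by polynomial-time parties, some of which may be
adversarial. It is determined by the public key and by its coins (the third argument of `view`
and of `oracle`). There are `honest k` honest full nodes, numbered from `0`. `view` is everything
that is known to the adversary at a given round; in particular the dirty ledger of each honest
full node is obtained from it by `read`. `oracle` is the consensus oracle `CO_r(tx, tx')`, a
black box. -/
structure Consensus where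
  honest : ℕ → ℕ
  coins : Polynomial ℕ
  view : ℕ → Key → Bits → ℕ → Bits
  read : ℕ → Key → Bits → ℕ → List Tx
  oracle : ℕ → Key → Bits → ℕ → Tx → Tx → Bool
  view_polyTime : PolyTime fun x : ℕ × Key × Bits × ℕ => view x.1 x.2.1 x.2.2.1 x.2.2.2
  read_polyTime : PolyTime fun x : ℕ × Key × Bits × ℕ => read x.1 x.2.1 x.2.2.1 x.2.2.2

namespace Consensus

variable (C : Consensus) (𝓗 : HashFamily)

/-- The coins of the execution at security parameter `k`. -/
abbrev ExecCoins (k : ℕ) := Coins (C.coins.eval k)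

/-- The dirty ledger of the honest full node `P` at round `r`. -/
def ledger (k : ℕ) (s : Key) (w : Bits) (P r : ℕ) : List Tx := C.read k s (C.view k s w r) P

/-- The longest dirty ledger kept by an honest full node at round `r`. -/
def longest (k : ℕ) (s : Key) (w : Bits) (r : ℕ) : List Tx :=
  (((List.range (C.honest k)).map fun P => C.ledger k s w P r).argmax List.length).getD []

/-- Ledger safety. -/
def Safe : Prop :=
  ∀ (k : ℕ) (g : 𝓗.KeyCoins k) (w : C.ExecCoins k) (P₁ P₂ r₁ r₂ : ℕ),
    P₁ < C.honest k → P₂ < C.honest k → r₁ < r₂ →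
      C.ledger k (𝓗.key k g) (List.ofFn w) P₁ r₁ <+: C.ledger k (𝓗.key k g) (List.ofFn w) P₂ r₂

/-- No transaction occurs twice on a dirty ledger, and the empty string, which stands for the
missing genesis transaction, does not occur. -/
def DistinctTransactions : Prop :=
  ∀ (k : ℕ) (g : 𝓗.KeyCoins k) (w : C.ExecCoins k) (P r : ℕ), P < C.honest k →
    ([] :: C.ledger k (𝓗.key k g) (List.ofFn w) P r).Nodup

/-- `tx'` immediately follows `tx` on the longest honest ledger at round `r`, where the first
transaction is considered to follow the empty string. -/
def Follows (k : ℕ) (s : Key) (w : Bits) (r : ℕ) (tx tx' : Tx) : Prop :=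
  [tx, tx'] <:+: [] :: C.longest k s w r

/-- Completeness of the consensus oracle. -/
def Complete : Prop :=
  ∀ (k : ℕ) (g : 𝓗.KeyCoins k) (w : C.ExecCoins k) (r : ℕ) (tx tx' : Tx),
    C.Follows k (𝓗.key k g) (List.ofFn w) r tx tx' →
      C.oracle k (𝓗.key k g) (List.ofFn w) r tx tx' = true

/-- Soundness of the consensus oracle with delay parameter `ν`: a PPT adversary, which chooses a
round `r` and receives the view at that round, does not find transactions that the oracle accepts
at round `r` although they are not consecutive on the longest honest ledger at round `r + ν`. -/
def Sound (ν : ℕ) : Prop :=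
  ∀ (q : Polynomial ℕ) (R : ℕ × Key × Bits → ℕ) (A : ℕ × Key × Bits × Bits → Tx × Tx),
    PolyTime R → PolyTime A →
    Negligible fun k => prob fun ω : 𝓗.KeyCoins k × C.ExecCoins k × Coins (q.eval k) =>
      let s := 𝓗.key k ω.1
      let w := List.ofFn ω.2.1
      let ρ := List.ofFn ω.2.2
      let r := R (k, s, ρ)
      let a := A (k, s, ρ, C.view k s w r)
      C.oracle k s w r a.1 a.2 = true ∧ ¬ C.Follows k s w (r + ν) a.1 a.2

end Consensus

/-! ## Merkle trees and Merkle mountain ranges -/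

/-- The string that is hashed at a leaf. -/
def leafString (e : Entry) : Bits := concat e.1 e.2

inductive MerkleTree where
  | leaf : Entry → MerkleTree
  | node : MerkleTree → MerkleTree → MerkleTree

namespace MerkleTree

def leaves : MerkleTree → ℕ
  | leaf _ => 1
  | node l r => l.leaves + r.leaves

def root (H : Bits → Bits) : MerkleTree → Bits
  | leaf e => H (leafString e)
  | node l r => H (concat (l.root H) (r.root H))

def left : MerkleTree → MerkleTree
  | leaf e => leaf e
  | node l _ => l

def right : MerkleTree → MerkleTree
  | leaf e => leaf e
  | node _ r => r

/-- The Merkle tree of height `q` whose leaves are the first `2 ^ q` elements of `D`. -/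
def make : ℕ → List Entry → MerkleTree
  | 0, D => leaf (D.headD ([], []))
  | q + 1, D => node (make q (D.take (2 ^ q))) (make q (D.drop (2 ^ q)))

end MerkleTree

/-- The heights of the trees of a Merkle mountain range with `n` leaves, in decreasing order:
the exponents in the binary expansion of `n`. -/
def heights (n : ℕ) : List ℕ := n.bitIndices.reverse

/-- Consecutive segments of `D` of lengths `2 ^ q`, for `q` in the list, made into trees. -/
def makeTrees : List ℕ → List Entry → List MerkleTree
  | [], _ => []
  | q :: qs, D => MerkleTree.make q (D.take (2 ^ q)) :: makeTrees qs (D.drop (2 ^ q))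

def makeMMR (D : List Entry) : List MerkleTree := makeTrees (heights D.length) D

/-- An alleged peak: the height of its tree and the alleged root. -/
abbrev Peak := ℕ × Bits

/-- The root that a Merkle proof (the siblings, from the leaf upwards) yields for the hash `h`
at index `i`. -/
def climb (H : Bits → Bits) : List Bits → ℕ → Bits → Bits
  | [], _, h => h
  | x :: π, i, h => climb H π (i / 2) (if i % 2 = 0 then H (concat h x) else H (concat x h))

/-- Verification of a Merkle proof for the `i`-th leaf `e` of a tree of height `q`. -/
def verifyTree (H : Bits → Bits) (π : List Bits) (q : ℕ) (root : Bits) (i : ℕ) (e : Entry) : Bool :=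
  π.length == q && climb H π i (H (leafString e)) == root

/-- Verification of a Merkle proof for the entry `e` with index `j` in a mountain range, with
respect to the peak above that entry. -/
def verifyEntry (H : Bits → Bits) (π : List Bits) : List Peak → ℕ → Entry → Bool
  | [], _, _ => false
  | (q, h) :: ps, j, e => if j < 2 ^ q then verifyTree H π q h j e
      else verifyEntry H π ps (j - 2 ^ q) e

def totalLeaves (ps : List Peak) : ℕ := (ps.map fun p => 2 ^ p.1).sum

/-! ## The challenge game -/

/-- The result of the zooming phase. -/
inductive Zoom where
  /-- Play the bisection game on the responder's peak with number `i` and the challenger's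
  subtree `T`. -/
  | bisection (i : ℕ) (T : MerkleTree) : Zoom
  /-- No disagreement was found. -/
  | monologue : Zoom

/-- Zooming within a tree of the challenger, which lies above all the remaining peaks of the
responder; `i` is the number of the first remaining peak. -/
def treeVsPeaks (H : Bits → Bits) : MerkleTree → List Peak → ℕ → Zoom
  | _, [], _ => .monologue
  | .leaf _, _ :: _, _ => .monologue
  | .node l r, p :: ps, i =>
      if totalLeaves (p :: ps) < l.leaves then treeVsPeaks H l (p :: ps) i
      else if l.root H = p.2 then treeVsPeaks H r ps (i + 1)
      else .bisection i l

/-- Zooming: the challenger's trees against the responder's peaks; `i` is the number of the first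
peak in the list. -/
def peaksVsPeaks (H : Bits → Bits) : List MerkleTree → List Peak → ℕ → Zoom
  | _, [], _ => .monologue
  | [], _ :: _, _ => .monologue
  | T :: Ts, p :: ps, i =>
      if T.leaves = 2 ^ p.1 then
        if T.root H = p.2 then peaksVsPeaks H Ts ps (i + 1) else .bisection i T
      else treeVsPeaks H T (p :: ps) i

/-- The initial claim of the responder: the size of its augmented dirty ledger, the peaks, the
last entry and a Merkle proof for it. -/
structure Claim where
  size : ℕ
  peaks : List Bits
  last : Entry
  proof : List Bits

instance : Enc Claim where
  enc c := enc (c.size, c.peaks, c.last, c.proof)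
  enc_injective := by
    rintro ⟨a, b, c, d⟩ ⟨a', b', c', d'⟩ h
    have := enc_injective h
    simp only [Prod.mk.injEq] at this
    obtain ⟨rfl, rfl, rfl, rfl⟩ := this
    rfl

/-- The alleged peaks with their heights, which are determined by the alleged size. -/
def Claim.alleged (c : Claim) : List Peak := (heights c.size).zip c.peaks

/-- The verifier's check of the initial claim. -/
def Claim.valid (H : Bits → Bits) (c : Claim) : Bool :=
  c.peaks.length == (heights c.size).length &&
    (c.size != 0 && verifyEntry H c.proof c.alleged (c.size - 1) c.last)

/-- The final message of the responder in a bisection game that ends at index `j`: the `j`-th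
entry, the entry before it with its Merkle proof (ignored if `j = 0`), and a proof of the state
transition between them. -/
structure Reveal where
  entry : Entry
  prev : Entry
  prevProof : List Bits
  transition : Bits

instance : Enc Reveal where
  enc o := enc (o.entry, o.prev, o.prevProof, o.transition)
  enc_injective := by
    rintro ⟨a, b, c, d⟩ ⟨a', b', c', d'⟩ h
    have := enc_injective h
    simp only [Prod.mk.injEq] at this
    obtain ⟨rfl, rfl, rfl, rfl⟩ := this
    rfl

inductive Verdict where
  | challenger : Verdict
  | responder : Verdict
  | both : Verdict

/-- What the verifier knows and can ask: the hash function, the genesis commitment, the consensus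
oracle and the succinct transition function. -/
structure Verifier where
  H : Bits → Bits
  genesis : Commitment
  oracle : Tx → Tx → Bool
  succinct : Commitment → Tx → Bits → Option Commitment

namespace Verifier

variable (V : Verifier)

/-- The verifier's check of the transition from the entry `e` to the entry `e'`. -/
def checkTransition (e e' : Entry) (π : Bits) : Bool :=
  V.oracle e.1 e'.1 && V.succinct e.2 e'.1 π == some e'.2

/-- The verifier's check of the final message of a bisection game that ends at index `j`, at a leaf
with alleged hash `h`. -/
def checkReveal (peaks : List Peak) (j : ℕ) (h : Bits) (o : Reveal) : Bool :=
  V.H (leafString o.entry) == h &&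
    if j = 0 then o.entry == ([], V.genesis)
    else verifyEntry V.H o.prevProof peaks (j - 1) o.prev && V.checkTransition o.prev o.entry o.transition

/-- The honest challenger's next query, when his current node is `T` and the responder has revealed
`hl` as the left child of the corresponding node: right (`true`) if the left children agree, left
(`false`) if they do not. -/
def nextQuery (T : MerkleTree) (hl : Bits) : Bool := T.left.root V.H == hl

/-- The `q` rounds in which inner nodes are opened, for an honest challenger. `answer path` is the
responder's answer when asked for the children of the node at `path` (`none` for a time-out or an
answer that is not syntactically valid), `T` is the challenger's node at that position, and `h` the
responder's alleged hash. The result is the path to the leaf and the alleged hash of the leaf, or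
`none` if the verifier has caught the responder. -/
def descend (answer : List Bool → Option (Bits × Bits)) :
    ℕ → MerkleTree → Bits → List Bool → Option (List Bool × Bits)
  | 0, _, h, path => some (path, h)
  | q + 1, T, h, path =>
      match answer path with
      | none => none
      | some (hl, hr) =>
          if V.H (concat hl hr) = h then
            if V.nextQuery T hl then descend answer q T.right hr (path ++ [true])
            else descend answer q T.left hl (path ++ [false])
          else none

/-- The position of a leaf within its tree, from the path that leads to it. -/
def pathIndex (path : List Bool) : ℕ := path.foldl (fun n b => 2 * n + b.toNat) 0

/-- The bisection game, for an honest challenger with subtree `T`, on the peak with number `i`. -/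
def bisectionGame (peaks : List Peak) (i : ℕ) (T : MerkleTree)
    (openNode : ℕ × List Bool → Option (Bits × Bits)) (openLeaf : ℕ × List Bool → Option Reveal) :
    Verdict :=
  match peaks[i]? with
  | none => .responder
  | some (q, h) =>
      match V.descend (fun path => openNode (i, path)) q T h [] with
      | none => .challenger
      | some (path, h') =>
          match openLeaf (i, path) with
          | none => .challenger
          | some o =>
              if V.checkReveal peaks (totalLeaves (peaks.take i) + pathIndex path) h' o
              then .responder else .challenger

/-- The verifier's check of a suffix, whose entries come with proofs of the state transitions, against
the entry `e` before it. -/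
def checkSuffix : Entry → List (Entry × Bits) → Bool
  | _, [] => true
  | e, (e', π) :: rest => V.checkTransition e e' π && checkSuffix e' rest

/-- The suffix monologue: `last` is the last entry of the responder, `suffix` is what the challenger
presents, and `long` says whether the challenger has more extra entries than the verifier checks. -/
def suffixMonologue (last : Entry) (suffix : List (Entry × Bits)) (long : Bool) : Verdict :=
  if V.checkSuffix last suffix then (if long then .challenger else .both) else .responder

/-- The challenge game of an honest challenger with augmented dirty ledger `D` against a responder
with initial claim `c`. `witness j` is the challenger's proof of the transition from entry `j - 1` to
entry `j`, and `bound` is the number of extra entries that the verifier checks. -/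
def challengeGame (D : List Entry) (witness : ℕ → Bits) (bound : ℕ) (c : Claim)
    (openNode : ℕ × List Bool → Option (Bits × Bits)) (openLeaf : ℕ × List Bool → Option Reveal) :
    Verdict :=
  match peaksVsPeaks V.H (makeMMR D) c.alleged 0 with
  | .bisection i T => V.bisectionGame c.alleged i T openNode openLeaf
  | .monologue =>
      V.suffixMonologue c.last
        ((List.range' c.size (min D.length (c.size + bound) - c.size)).map
          fun j => (D.getD j ([], []), witness j))
        (decide (c.size + bound < D.length))

end Verifier

/-- A PPT adversarial responder. From the key and its coins it chooses the round at which the game is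
played; then it receives the view of that round, chooses its honest opponent, makes its initial claim
(`none` if there is none) and answers queries. Its answers depend on all queries it has received so
far, which are given by the number of the peak and the path (`false`: left) to the current node. -/
structure Responder where
  coins : Polynomial ℕ
  round : ℕ × Key × Bits → ℕ
  opponent : ℕ × Key × Bits × Bits → ℕ
  claim : ℕ × Key × Bits × Bits → Option Claim
  openNode : (ℕ × Key × Bits × Bits) × ℕ × List Bool → Option (Bits × Bits)
  openLeaf : (ℕ × Key × Bits × Bits) × ℕ × List Bool → Option Reveal
  round_polyTime : PolyTime round
  opponent_polyTime : PolyTime opponent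
  claim_polyTime : PolyTime claim
  openNode_polyTime : PolyTime openNode
  openLeaf_polyTime : PolyTime openLeaf

/-- The coins of an experiment: of the key generator, of the consensus execution, of the responder,
and of the honest challenger, who has `tape k` coins for each of the at most `bound` proofs. -/
abbrev Sample (𝓗 : HashFamily) (C : Consensus) (A : Responder) (tape : ℕ → ℕ) (bound k : ℕ) :=
  𝓗.KeyCoins k × C.ExecCoins k × Coins (A.coins.eval k) × (Fin bound → Coins (tape k))

/-- The outcome of the experiment in which the responder `A` meets an honest prover: `none` if the
verifier does not start a challenge game with `A` as the responder, that is, if the claim of `A` is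
missing or invalid, or equal to that of the honest prover, or larger in size. -/
def experiment (𝓗 : HashFamily) (X : ExecutionLayer) (C : Consensus) (A : Responder)
    (tape : ℕ → ℕ) (bound k : ℕ) (ω : Sample 𝓗 C A tape bound k) : Option Verdict :=
  let s := 𝓗.key k ω.1
  let w := List.ofFn ω.2.1
  let ρ := List.ofFn ω.2.2.1
  let r := A.round (k, s, ρ)
  let info := (k, s, ρ, C.view k s w r)
  let P := A.opponent info
  let L := C.ledger k s w P r
  let D := X.augment k s L
  let V : Verifier :=
    { H := 𝓗.hash k s
      genesis := X.commit k s (X.genesis k s)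
      oracle := C.oracle k s w r
      succinct := X.succinct k s }
  match A.claim info with
  | none => none
  | some c =>
      let witness := fun j => X.prove k s (X.run k s (L.take (j - 1))) (L.getD (j - 1) [])
        (if h : j - c.size < bound then List.ofFn (ω.2.2.2 ⟨j - c.size, h⟩) else [])
      if P < C.honest k ∧ c.valid V.H = true ∧ c.size ≤ D.length ∧
          (c.peaks, c.size) ≠ ((makeMMR D).map (MerkleTree.root V.H), D.length) then
        some (V.challengeGame D witness bound c
          (fun query => A.openNode (info, query)) (fun query => A.openLeaf (info, query)))
      else none

/-- If the challenge game is played, then the challenger is among the winners. -/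
def ChallengerWins (outcome : Option Verdict) : Prop :=
  ∀ v, outcome = some v → v = .challenger ∨ v = .both

end LightClient

/-!
Whenever the honest challenger loses, the messages of the responder contain one of three things.

* The responder opens or proves something that contradicts what has been hashed before. The hashes
  that the challenger meets while zooming are those of aligned subtrees over his own entries
  (`peaksVsPeaks_correct`). In the suffix monologue the last entry of the responder therefore hangs
  below a peak of the honest mountain range, so that it is the honest entry or its Merkle proof
  contains a collision (`eq_or_honestCollision`). In the bisection game the descent ends at a leaf
  with a wrong hash. The entry before that leaf is below the left child of a node at which the
  challenger went right, hence below an honest hash, or below an earlier peak, which is honest too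
  (`descend_eq_some`). Again it is the honest entry, unless there is a collision with a string that
  is hashed in the honest mountain range or in the opening of a node.
* Otherwise the responder has shown a wrong entry after the correct one. If its transaction is not
  the next one on the honest ledger, then the consensus oracle has accepted two transactions that
  do not follow each other on the later ledger, which extends the honest one and has no
  duplicates.
* If its transaction is the correct one, then its commitment is not, and the proof of the state
  transition breaks the execution oracle (`Responder.consensusEvent_or_executionEvent`).

The suffix of an honest challenger always passes the checks, by completeness of the oracles.

Each case has to be turned into a polynomial-time adversary. Instead of simulating the game, the
adversaries guess the place in the trees where the relevant message is asked for. All ledgers have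
polynomial length, so such a place is described by a string of logarithmic length, and random coins
begin with this string with probability at least the inverse of a polynomial
(`Responder.exists_guess`, `prob_exists_prefix_le`). The adversaries are shown to be efficient by a
small calculus of polynomial-time functions, whose main rule is that for folds over lists
(`PolyTime.foldl`).
-/

namespace LightClient

open Enc (enc enc_injective)

/-! ### Sizes of encodings and polynomial bounds -/

/-- The size of the encoding of an element. This is the input size in `PolyTime`. -/
def sz {α : Type} [Enc α] (a : α) : ℕ := (enc a).size

theorem Tree.size_pos (x : Tree) : 1 ≤ x.size := by
  cases x <;> simp [Tree.size]

theorem one_le_sz {α : Type} [Enc α] (a : α) : 1 ≤ sz a := Tree.size_pos _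

section

variable {α β γ σ : Type} [Enc α] [Enc β] [Enc γ] [Enc σ]

@[simp] theorem sz_pair (a : α) (b : β) : sz (a, b) = sz a + sz b + 1 := rfl

@[simp] theorem sz_list_nil : sz ([] : List α) = 1 := rfl

@[simp] theorem sz_list_cons (a : α) (l : List α) : sz (a :: l) = sz a + sz l + 1 := rfl

theorem sz_nat (n : ℕ) : sz n = 2 * n + 1 := by
  induction n with
  | zero => rfl
  | succ n ih =>
    have : sz (n + 1) = 1 + sz n + 1 := rfl
    omega

theorem sz_bool_le (b : Bool) : sz b ≤ 3 := by
  cases b <;> simp [sz, enc, Tree.size]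

theorem sz_append (l l' : List α) : sz (l ++ l') + 1 = sz l + sz l' := by
  induction l with
  | nil => simp; omega
  | cons a l ih => simp only [List.cons_append, sz_list_cons]; omega

theorem sz_reverse (l : List α) : sz l.reverse = sz l := by
  induction l with
  | nil => rfl
  | cons a l ih =>
    have := sz_append l.reverse [a]
    simp only [List.reverse_cons, sz_list_cons, sz_list_nil] at *
    omega

theorem length_le_sz (l : List α) : l.length ≤ sz l := by
  induction l with
  | nil => simp
  | cons a l ih => simp only [List.length_cons, sz_list_cons]; omega

theorem sz_le_of_mem {l : List α} {a : α} (h : a ∈ l) : sz a ≤ sz l := by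
  induction l with
  | nil => simp at h
  | cons b l ih =>
    simp only [sz_list_cons]
    rcases List.mem_cons.1 h with rfl | h
    · omega
    · have := ih h; omega

theorem sz_list_le {l : List α} {M : ℕ} (h : ∀ a ∈ l, sz a ≤ M) :
    sz l ≤ l.length * (M + 1) + 1 := by
  induction l with
  | nil => simp
  | cons a l ih =>
    have h1 := h a (by simp)
    have h2 := ih fun b hb => h b (by simp [hb])
    simp only [sz_list_cons, List.length_cons, Nat.succ_mul]
    omega

theorem sz_bits_le (l : Bits) : sz l ≤ 4 * l.length + 1 := by
  have := sz_list_le (l := l) (M := 3) fun b _ => sz_bool_le b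
  omega

theorem sz_prefix_le {l l' : List α} (h : l <+: l') : sz l ≤ sz l' := by
  obtain ⟨t, rfl⟩ := h
  have := sz_append l t
  have := one_le_sz t
  omega

/-- Polynomials with natural coefficients are monotone. -/
theorem eval_mono (p : Polynomial ℕ) {m n : ℕ} (h : m ≤ n) : p.eval m ≤ p.eval n := by
  simp only [Polynomial.eval_eq_sum, Polynomial.sum]
  gcongr

/-- The function `f` is bounded by a polynomial in the size of its argument. With such bounds in
place of polynomials, running times need not be computed exactly. -/
def PolyBdd (f : α → ℕ) : Prop := ∃ p : Polynomial ℕ, ∀ a, f a ≤ p.eval (sz a)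

namespace PolyBdd

theorem mono {f g : α → ℕ} (hg : PolyBdd g) (h : ∀ a, f a ≤ g a) : PolyBdd f := by
  obtain ⟨p, hp⟩ := hg
  exact ⟨p, fun a => (h a).trans (hp a)⟩

theorem const (n : ℕ) : PolyBdd fun _ : α => n := ⟨Polynomial.C n, by simp⟩

theorem sz : PolyBdd fun a : α => sz a := ⟨Polynomial.X, by simp⟩

theorem add {f g : α → ℕ} (hf : PolyBdd f) (hg : PolyBdd g) : PolyBdd fun a => f a + g a := by
  obtain ⟨p, hp⟩ := hf
  obtain ⟨q, hq⟩ := hg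
  exact ⟨p + q, fun a => by rw [Polynomial.eval_add]; exact add_le_add (hp a) (hq a)⟩

theorem mul {f g : α → ℕ} (hf : PolyBdd f) (hg : PolyBdd g) : PolyBdd fun a => f a * g a := by
  obtain ⟨p, hp⟩ := hf
  obtain ⟨q, hq⟩ := hg
  exact ⟨p * q, fun a => by rw [Polynomial.eval_mul]; exact Nat.mul_le_mul (hp a) (hq a)⟩

theorem eval (p : Polynomial ℕ) {f : α → ℕ} (hf : PolyBdd f) : PolyBdd fun a => p.eval (f a) := by
  obtain ⟨q, hq⟩ := hf
  exact ⟨p.comp q, fun a => by rw [Polynomial.eval_comp]; exact eval_mono p (hq a)⟩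

theorem comp {f : β → ℕ} (hf : PolyBdd f) {g : α → β} (hg : PolyBdd fun a => LightClient.sz (g a)) :
    PolyBdd fun a => f (g a) := by
  obtain ⟨p, hp⟩ := hf
  exact (hg.eval p).mono fun a => hp _

end PolyBdd

/-! ### A calculus of polynomial-time functions -/

/-- Writing the output takes at least as many steps as it has nodes. -/
theorem Prog.Run.size_le {c : Prog} {x y : Tree} {t : ℕ} (h : c.Run x y t) : y.size ≤ t := by
  induction h with
  | nil x => simp [Tree.size]
  | copy x => exact le_rfl
  | head x => cases x <;> simp [Tree.size, Tree.head]; omega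
  | tail x => cases x <;> simp [Tree.size, Tree.tail]; omega
  | equal x =>
    cases x with
    | nil => simp [Tree.size, Tree.equal]
    | cons a b =>
      simp only [Tree.equal]
      split_ifs
      · simp [Tree.size]
      · simp [Tree.size]
  | comp _ _ _ _ => omega
  | pair _ _ _ _ => simp only [Tree.size]; omega
  | branch_true _ _ _ _ _ => omega
  | branch_false _ _ _ _ => omega
  | loop_stop _ _ => omega
  | loop_step _ _ _ _ _ _ _ => omega

namespace PolyTime

/-- The running time may be bounded by any polynomially bounded function of the input. -/
theorem of_bound {f : α → β} (c : Prog) {T : α → ℕ} (hT : PolyBdd T)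
    (h : ∀ a, ∃ t ≤ T a, c.Run (enc a) (enc (f a)) t) : PolyTime f := by
  obtain ⟨p, hp⟩ := hT
  refine ⟨c, p, fun a => ?_⟩
  obtain ⟨t, ht, hr⟩ := h a
  exact ⟨t, ht.trans (hp a), hr⟩

theorem polyBdd {f : α → β} (hf : PolyTime f) : PolyBdd fun a => sz (f a) := by
  obtain ⟨c, p, h⟩ := hf
  refine ⟨p, fun a => ?_⟩
  obtain ⟨t, ht, hr⟩ := h a
  exact hr.size_le.trans ht

/-- A function that does not change the encoding is computed by copying. -/
theorem of_enc_eq {f : α → β} (h : ∀ a, enc (f a) = enc a) : PolyTime f :=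
  of_bound .copy .sz fun a => ⟨sz a, le_rfl, by rw [h]; exact .copy _⟩

theorem of_enc_eq_head {f : α → β} (h : ∀ a, enc (f a) = (enc a).head) : PolyTime f :=
  of_bound .head .sz fun a => ⟨sz a, le_rfl, by rw [h]; exact .head _⟩

theorem of_enc_eq_tail {f : α → β} (h : ∀ a, enc (f a) = (enc a).tail) : PolyTime f :=
  of_bound .tail .sz fun a => ⟨sz a, le_rfl, by rw [h]; exact .tail _⟩

theorem id : PolyTime fun a : α => a := of_enc_eq fun _ => rfl

theorem comp {g : β → γ} {f : α → β} (hg : PolyTime g) (hf : PolyTime f) :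
    PolyTime fun a => g (f a) := by
  have hb := hf.polyBdd
  obtain ⟨cg, pg, hg⟩ := hg
  obtain ⟨cf, pf, hf⟩ := hf
  refine of_bound (.comp cg cf) (((PolyBdd.sz.eval pf).add (hb.eval pg)).add (.const 1))
    fun a => ?_
  obtain ⟨t, ht, hr⟩ := hf a
  obtain ⟨t', ht', hr'⟩ := hg (f a)
  exact ⟨t + t' + 1, add_le_add (add_le_add ht ht') le_rfl, .comp hr hr'⟩

theorem pair {f : α → β} {g : α → γ} (hf : PolyTime f) (hg : PolyTime g) :
    PolyTime fun a => (f a, g a) := by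
  obtain ⟨cg, pg, hg⟩ := hg
  obtain ⟨cf, pf, hf⟩ := hf
  refine of_bound (.pair cf cg) (((PolyBdd.sz.eval pf).add (PolyBdd.sz.eval pg)).add (.const 1))
    fun a => ?_
  obtain ⟨t, ht, hr⟩ := hf a
  obtain ⟨t', ht', hr'⟩ := hg a
  exact ⟨t + t' + 1, add_le_add (add_le_add ht ht') le_rfl, .pair hr hr'⟩

theorem fst {f : α → β × γ} (hf : PolyTime f) : PolyTime fun a => (f a).1 :=
  (of_enc_eq_head (f := Prod.fst) fun _ => rfl).comp hf

theorem snd {f : α → β × γ} (hf : PolyTime f) : PolyTime fun a => (f a).2 :=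
  (of_enc_eq_tail (f := Prod.snd) fun _ => rfl).comp hf

theorem exists_run_const (y : Tree) :
    ∃ (c : Prog) (n : ℕ), ∀ x, ∃ t ≤ n, c.Run x y t := by
  induction y with
  | nil => exact ⟨.nil, 1, fun x => ⟨1, le_rfl, .nil x⟩⟩
  | cons a b iha ihb =>
    obtain ⟨ca, na, ha⟩ := iha
    obtain ⟨cb, nb, hb⟩ := ihb
    refine ⟨.pair ca cb, na + nb + 1, fun x => ?_⟩
    obtain ⟨t, ht, hr⟩ := ha x
    obtain ⟨t', ht', hr'⟩ := hb x
    exact ⟨t + t' + 1, by omega, .pair hr hr'⟩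

theorem const (b : β) : PolyTime fun _ : α => b := by
  obtain ⟨c, n, h⟩ := exists_run_const (enc b)
  exact of_bound c (.const n) fun a => h _

theorem cond {b : α → Bool} {f g : α → β} (hb : PolyTime b) (hf : PolyTime f) (hg : PolyTime g) :
    PolyTime fun a => if b a = true then f a else g a := by
  obtain ⟨cb, pb, hb⟩ := hb
  obtain ⟨cg, pg, hg⟩ := hg
  obtain ⟨cf, pf, hf⟩ := hf
  refine of_bound (.branch cb cf cg)
    (((PolyBdd.sz.eval pb).add ((PolyBdd.sz.eval pf).add (PolyBdd.sz.eval pg))).add (.const 1))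
    fun a => ?_
  obtain ⟨t, ht, hr⟩ := hb a
  obtain ⟨tf, htf, hrf⟩ := hf a
  obtain ⟨tg, htg, hrg⟩ := hg a
  simp only [sz]
  cases h : b a with
  | true =>
    rw [h] at hr
    exact ⟨t + tf + 1, by omega, by simpa using Prog.Run.branch_true hr (by simp [enc]) hrf⟩
  | false =>
    rw [h] at hr
    exact ⟨t + tg + 1, by omega, by simpa using Prog.Run.branch_false hr hrg⟩

open Classical in
theorem beq [BEq β] [LawfulBEq β] {f g : α → β} (hf : PolyTime f) (hg : PolyTime g) :
    PolyTime fun a => f a == g a := by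
  refine PolyTime.comp (g := fun x : β × β => x.1 == x.2) ?_ (hf.pair hg)
  refine of_bound .equal (PolyBdd.sz.add (.const 2)) fun a => ⟨sz a + 2, le_rfl, ?_⟩
  have h := Prog.Run.equal (enc a)
  refine (congrArg (fun y => Prog.equal.Run (enc a) y (sz a + 2)) ?_).mpr h
  change _ = if enc a.1 = enc a.2 then Tree.cons Tree.nil Tree.nil else Tree.nil
  by_cases h : a.1 = a.2
  · simp [h, enc]
  · simp [h, enc_injective.ne h, enc]

theorem and {f g : α → Bool} (hf : PolyTime f) (hg : PolyTime g) :
    PolyTime fun a => f a && g a := by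
  convert hf.cond hg (const false) using 2 with a
  cases f a <;> simp

theorem not {f : α → Bool} (hf : PolyTime f) : PolyTime fun a => !f a := by
  convert hf.cond (const false) (const true) using 2 with a
  cases f a <;> simp

theorem optionGetD {f : α → Option β} {d : α → β} (hf : PolyTime f) (hd : PolyTime d) :
    PolyTime fun a => (f a).getD (d a) := by
  obtain ⟨cd, pd, hd⟩ := hd
  have hb := hf.polyBdd
  obtain ⟨cf, pf, hf⟩ := hf
  refine of_bound (.branch cf (.comp .tail cf) cd)
    ((((PolyBdd.sz.eval pf).mul (.const 2)).add (hb.add (PolyBdd.sz.eval pd))).add (.const 2))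
    fun a => ?_
  obtain ⟨t, ht, hr⟩ := hf a
  obtain ⟨td, htd, hrd⟩ := hd a
  simp only [sz]
  cases h : f a with
  | none =>
    rw [h] at hr
    exact ⟨t + td + 1, by omega, .branch_false hr hrd⟩
  | some b =>
    rw [h] at hr
    exact ⟨t + (t + (enc (some b)).size + 1) + 1, by omega,
      .branch_true hr (by simp [enc]) (.comp hr (.tail _))⟩

theorem cons {f : α → β} {l : α → List β} (hf : PolyTime f) (hl : PolyTime l) :
    PolyTime fun a => f a :: l a :=
  (of_enc_eq (f := fun x : β × List β => x.1 :: x.2) fun _ => rfl).comp (hf.pair hl)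

theorem tail {l : α → List β} (hl : PolyTime l) : PolyTime fun a => (l a).tail := by
  refine (of_enc_eq_tail (f := List.tail) fun l => ?_).comp hl
  cases l <;> rfl

/-- The head of a list, with a default value that has the encoding of the empty list. -/
theorem headD {d : β} (hd : enc d = .nil) {l : α → List β} (hl : PolyTime l) :
    PolyTime fun a => (l a).headD d := by
  refine (of_enc_eq_head (f := fun l : List β => l.headD d) fun l => ?_).comp hl
  cases l
  · exact hd
  · rfl

theorem isEmpty {l : α → List β} (hl : PolyTime l) : PolyTime fun a => (l a).isEmpty := by
  have h : PolyTime fun l : List β => l.isEmpty := by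
    refine of_bound (.branch .copy .nil (.pair .nil .nil)) (PolyBdd.sz.add (.const 5)) fun l => ?_
    cases l with
    | nil =>
      exact ⟨1 + 3 + 1, by simp, .branch_false (.copy _) (.pair (.nil _) (.nil _))⟩
    | cons b l =>
      exact ⟨(enc (b :: l)).size + 1 + 1, by simp [sz],
        .branch_true (.copy _) (by simp [enc, encList]) (.nil _)⟩
  exact h.comp hl

/-- A loop that computes a fold: its state consists of the parameter, the accumulator and the
remaining list, and `cs` is a program for the step. -/
theorem exists_run_loop {step : σ → β → σ} {cs : Prog} {A : Tree} {B M : ℕ} (l : List β) (s : σ)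
    (hB : ∀ l', l' <+: l → sz (l'.foldl step s) ≤ B)
    (hs : ∀ s : σ, ∀ b ∈ l, sz s ≤ B → ∃ t ≤ M, cs.Run (.cons A (.cons (enc s) (enc b)))
      (enc (step s b)) t) :
    ∃ t ≤ (l.length + 1) * (M + 20 * (A.size + B + sz l + 10)),
      (Prog.loop (.comp .tail .tail) (.pair .head (.pair
        (.comp cs (.pair .head (.pair (.comp .head .tail) (.comp .head (.comp .tail .tail)))))
        (.comp .tail (.comp .tail .tail))))).Run
      (.cons A (.cons (enc s) (enc l))) (.cons A (.cons (enc (l.foldl step s)) .nil)) t := by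
  induction l generalizing s with
  | nil =>
    have h0 : sz s ≤ B := hB [] (List.prefix_rfl)
    refine ⟨_, ?_, Prog.Run.loop_stop (.comp (.tail _) (.tail _))⟩
    simp only [Tree.size, Tree.tail, enc, encList, List.length_nil, sz_list_nil]
    simp only [sz] at h0
    omega
  | cons b l ih =>
    have h0 : sz s ≤ B := hB [] (by simp)
    obtain ⟨t₁, ht₁, hr₁⟩ := hs s b (by simp) h0
    obtain ⟨t₂, ht₂, hr₂⟩ := ih (step s b)
      (fun l' hl' => hB (b :: l') (by simpa using hl'))
      (fun s' b' hb' => hs s' b' (by simp [hb']))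
    have h1 : sz (step s b) ≤ B := hB [b] (by simp)
    refine ⟨_, ?_, .loop_step (.comp (.tail _) (.tail _)) (by simp [enc, encList, Tree.tail])
      (.pair (.head _) (.pair (.comp (.pair (.head _) (.pair (.comp (.tail _) (.head _))
        (.comp (.comp (.tail _) (.tail _)) (.head _)))) hr₁)
        (.comp (.comp (.tail _) (.tail _)) (.tail _)))) hr₂⟩
    have h2 : (enc (b :: l)).size = sz b + sz l + 1 := rfl
    have h3 : (l.length + 1) * (M + 20 * (A.size + B + sz l + 10)) ≤
        (l.length + 1) * (M + 20 * (A.size + B + sz (b :: l) + 10)) := by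
      gcongr
      simp; omega
    have h4 : ((b :: l).length + 1) * (M + 20 * (A.size + B + sz (b :: l) + 10)) =
      (l.length + 1) * (M + 20 * (A.size + B + sz (b :: l) + 10)) +
        (M + 20 * (A.size + B + sz (b :: l) + 10)) := by
      simp only [List.length_cons]; ring
    rw [h4]
    refine le_trans ?_ (Nat.add_le_add_right h3 _)
    have h5 : (enc s).size = sz s := rfl
    have h6 : (enc b).size = sz b := rfl
    have h7 : (encList l).size = sz l := rfl
    simp only [Tree.size, Tree.tail, enc, encList, h7, sz_list_cons] at *
    simp only [h5, h6] at *
    omega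

/-- A fold is computed in polynomial time if its step is, and if all intermediate values of the
accumulator have polynomial size. -/
theorem foldl {l : α → List β} {init : α → σ} {step : α → σ → β → σ} {B : α → ℕ}
    (hl : PolyTime l) (hinit : PolyTime init)
    (hstep : PolyTime fun x : α × σ × β => step x.1 x.2.1 x.2.2)
    (hB : PolyBdd B) (h : ∀ a l', l' <+: l a → sz (l'.foldl (step a) (init a)) ≤ B a) :
    PolyTime fun a => (l a).foldl (step a) (init a) := by
  obtain ⟨cs, ps, hs⟩ := hstep
  have h₁ : PolyTime fun a => (a, init a, l a) := id.pair (hinit.pair hl)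
  have hbl := hl.polyBdd
  have hb₁ := h₁.polyBdd
  obtain ⟨c₁, p₁, h₁⟩ := h₁
  let M : α → ℕ := fun a => ps.eval (sz a + B a + sz (l a) + 2)
  have hM : PolyBdd M := (((PolyBdd.sz.add hB).add hbl).add (.const 2)).eval ps
  refine of_bound (.comp (.comp .head .tail) (.comp (.loop (.comp .tail .tail) (.pair .head (.pair
        (.comp cs (.pair .head (.pair (.comp .head .tail) (.comp .head (.comp .tail .tail)))))
        (.comp .tail (.comp .tail .tail))))) c₁))
    (T := fun a => p₁.eval (sz a) +
      (sz (l a) + 1) * (M a + 20 * (sz a + B a + sz (l a) + 10)) + 2 * (sz a + B a + 20)) ?_ ?_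
  · exact (((PolyBdd.sz.eval p₁).add ((hbl.add (.const 1)).mul (hM.add ((PolyBdd.const 20).mul
      (((PolyBdd.sz.add hB).add hbl).add (.const 10)))))).add ((PolyBdd.const 2).mul
      ((PolyBdd.sz.add hB).add (.const 20))))
  · intro a
    obtain ⟨t₁, ht₁, hr₁⟩ := h₁ a
    obtain ⟨t₂, ht₂, hr₂⟩ := exists_run_loop (step := step a) (cs := cs) (A := enc a) (B := B a)
      (M := M a) (l a) (init a) (h a) (by
        intro s b hb hsB
        obtain ⟨t, ht, hr⟩ := hs (a, s, b)
        refine ⟨t, ht.trans (eval_mono ps ?_), hr⟩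
        have := sz_le_of_mem hb
        change sz (a, s, b) ≤ _
        simp only [sz_pair]
        omega)
    refine ⟨_, ?_, .comp (.comp hr₁ hr₂) (.comp (.tail _) (.head _))⟩
    have h3 : ((l a).length + 1) * (M a + 20 * ((enc a).size + B a + sz (l a) + 10)) ≤
        (sz (l a) + 1) * (M a + 20 * (sz a + B a + sz (l a) + 10)) := by
      apply Nat.mul_le_mul
      · have := length_le_sz (l a); omega
      · exact le_rfl
    have h4 := h a (l a) List.prefix_rfl
    have h5 : (enc ((l a).foldl (step a) (init a))).size = sz ((l a).foldl (step a) (init a)) := rfl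
    have h6 : (enc a).size = sz a := rfl
    simp only [Tree.size, Tree.tail, h5]
    simp only [h6] at *
    omega

/-- A fold whose steps increase the size of the accumulator by an amount that depends only on the
parameter and on the element of the list. -/
theorem foldl_of_growth {l : α → List β} {init : α → σ} {step : α → σ → β → σ}
    (hl : PolyTime l) (hinit : PolyTime init)
    (hstep : PolyTime fun x : α × σ × β => step x.1 x.2.1 x.2.2)
    {G : α × β → ℕ} (hG : PolyBdd G) (h : ∀ a s b, sz (step a s b) ≤ sz s + G (a, b)) :
    PolyTime fun a => (l a).foldl (step a) (init a) := by
  obtain ⟨p, hp⟩ := hG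
  have hb : PolyBdd fun a => sz (init a) + sz (l a) * p.eval (sz a + sz (l a) + 1) :=
    hinit.polyBdd.add (hl.polyBdd.mul (((PolyBdd.sz.add hl.polyBdd).add (.const 1)).eval p))
  refine foldl hl hinit hstep hb fun a l' hl' => ?_
  have key : ∀ (l'' : List β) (s : σ), l'' ⊆ l a →
      sz (l''.foldl (step a) s) ≤ sz s + l''.length * p.eval (sz a + sz (l a) + 1) := by
    intro l''
    induction l'' with
    | nil => simp
    | cons b l'' ih =>
      intro s hsub
      have h1 := ih (step a s b) fun x hx => hsub (by simp [hx])
      have h2 := h a s b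
      have h3 := (hp (a, b)).trans (eval_mono p (n := sz a + sz (l a) + 1) (by
        have := sz_le_of_mem (hsub (List.mem_cons_self (a := b) (l := l'')))
        simp only [sz_pair]; omega))
      simp only [List.foldl_cons, List.length_cons, Nat.succ_mul]
      omega
  refine (key l' _ hl'.subset).trans ?_
  gcongr
  exact (length_le_sz l').trans (sz_prefix_le hl')

end PolyTime

end

/-! ### Polynomial-time functions on numbers and lists -/

instance : Enc Unit where
  enc _ := .nil
  enc_injective _ _ _ := rfl

section

variable {α β γ : Type} [Enc α] [Enc β] [Enc γ]

namespace PolyTime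

/-- A number in unary is encoded like a list of that length. -/
theorem replicate {n : α → ℕ} (hn : PolyTime n) : PolyTime fun a => List.replicate (n a) () := by
  refine (of_enc_eq (f := fun n => List.replicate n ()) fun n => ?_).comp hn
  induction n with
  | zero => rfl
  | succ n ih =>
    change Tree.cons Tree.nil (enc (List.replicate n ())) = Tree.cons Tree.nil (enc n)
    rw [ih]

theorem succ {n : α → ℕ} (hn : PolyTime n) : PolyTime fun a => n a + 1 :=
  (of_enc_eq (f := fun x : Unit × ℕ => x.2 + 1) fun _ => rfl).comp ((const ()).pair hn)

theorem pred {n : α → ℕ} (hn : PolyTime n) : PolyTime fun a => n a - 1 := by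
  refine (of_enc_eq_tail (f := fun n : ℕ => n - 1) fun n => ?_).comp hn
  cases n <;> rfl

theorem reverse {l : α → List β} (hl : PolyTime l) : PolyTime fun a => (l a).reverse := by
  have h := foldl_of_growth (step := fun (_ : α) (s : List β) (b : β) => b :: s) hl (const [])
    (id.snd.snd.cons id.snd.fst) (G := fun x => sz x) .sz (fun a s b => by simp; omega)
  convert h using 2 with a
  have key : ∀ l s : List β, l.foldl (fun s b => b :: s) s = l.reverse ++ s := by
    intro l
    induction l with
    | nil => simp
    | cons b l ih => intro s; simp [ih]
  simp [key]

theorem length {l : α → List β} (hl : PolyTime l) : PolyTime fun a => (l a).length := by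
  have h := foldl_of_growth (step := fun (_ : α) (s : ℕ) (_ : β) => s + 1) hl (const 0)
    id.snd.fst.succ (G := fun _ => 2) (.const 2) (fun a s b => by simp only [sz_nat]; omega)
  convert h using 2 with a
  have key : ∀ (l : List β) (s : ℕ), l.foldl (fun s _ => s + 1) s = l.length + s := by
    intro l
    induction l with
    | nil => simp
    | cons b l ih => intro s; simp only [List.foldl_cons, ih, List.length_cons]; omega
  simp [key]

theorem add {m n : α → ℕ} (hm : PolyTime m) (hn : PolyTime n) : PolyTime fun a => m a + n a := by
  have h := foldl_of_growth (step := fun (_ : α) (s : ℕ) (_ : Unit) => s + 1) hn.replicate hm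
    id.snd.fst.succ (G := fun _ => 2) (.const 2) (fun a s b => by simp only [sz_nat]; omega)
  convert h using 2 with a
  induction n a with
  | zero => rfl
  | succ k ih => rw [List.replicate_succ', List.foldl_append, ← ih]; rfl

theorem mul {m n : α → ℕ} (hm : PolyTime m) (hn : PolyTime n) : PolyTime fun a => m a * n a := by
  have h := foldl_of_growth (step := fun (a : α) (s : ℕ) (_ : Unit) => s + m a) hn.replicate
    (const 0) (id.snd.fst.add (hm.comp id.fst)) (G := fun x => 2 * sz (m x.1))
    ((PolyBdd.const 2).mul (hm.comp id.fst).polyBdd)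
    (fun a s b => by simp only [sz_nat]; omega)
  convert h using 2 with a
  induction n a with
  | zero => rfl
  | succ k ih => rw [List.replicate_succ', List.foldl_append, ← ih]; rfl

theorem polynomialEval (p : Polynomial ℕ) {n : α → ℕ} (hn : PolyTime n) :
    PolyTime fun a => p.eval (n a) := by
  induction p using Polynomial.induction_on' with
  | add p q hp hq => simpa only [Polynomial.eval_add] using hp.add hq
  | monomial d c =>
    simp only [Polynomial.eval_monomial]
    refine (const c).mul ?_
    induction d with
    | zero => simpa using const 1
    | succ d ih => simpa only [pow_succ] using ih.mul hn

theorem drop {n : α → ℕ} {l : α → List β} (hn : PolyTime n) (hl : PolyTime l) :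
    PolyTime fun a => (l a).drop (n a) := by
  have h := foldl_of_growth (step := fun (_ : α) (s : List β) (_ : Unit) => s.tail) hn.replicate hl
    id.snd.fst.tail (G := fun _ => 0) (.const 0) (fun a s b => by cases s <;> simp; omega)
  convert h using 2 with a
  induction n a with
  | zero => rfl
  | succ k ih =>
    rw [List.replicate_succ', List.foldl_append, ← ih]
    simp

theorem sub {m n : α → ℕ} (hm : PolyTime m) (hn : PolyTime n) : PolyTime fun a => m a - n a := by
  have h := foldl_of_growth (step := fun (_ : α) (s : ℕ) (_ : Unit) => s - 1) hn.replicate hm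
    id.snd.fst.pred (G := fun _ => 0) (.const 0) (fun a s b => by simp only [sz_nat]; omega)
  convert h using 2 with a
  induction n a with
  | zero => rfl
  | succ k ih => rw [List.replicate_succ', List.foldl_append, ← ih]; rfl

/-- The first elements of a list are what remains of the reversed list when the others are dropped
from it. -/
theorem take {n : α → ℕ} {l : α → List β} (hn : PolyTime n) (hl : PolyTime l) :
    PolyTime fun a => (l a).take (n a) := by
  have h := ((hl.length.sub hn).drop hl.reverse).reverse
  convert h using 2 with a
  rw [List.drop_reverse, List.reverse_reverse]
  rcases le_total (n a) (l a).length with h | h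
  · congr 1; omega
  · rw [List.take_of_length_le h, List.take_of_length_le]; omega

theorem getD {n : α → ℕ} {d : β} (hd : enc d = .nil) {l : α → List β} (hn : PolyTime n)
    (hl : PolyTime l) : PolyTime fun a => (l a).getD (n a) d := by
  convert (hn.drop hl).headD hd using 2 with a
  simp [List.headD_eq_head?_getD]

theorem map {l : α → List β} {f : α → β → γ} (hl : PolyTime l)
    (hf : PolyTime fun x : α × β => f x.1 x.2) : PolyTime fun a => (l a).map (f a) := by
  have h := (foldl_of_growth (step := fun (a : α) (s : List γ) (b : β) => f a b :: s) hl (const [])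
    ((hf.comp (id.fst.pair id.snd.snd)).cons id.snd.fst) (G := fun x => sz (f x.1 x.2) + 1)
    (hf.polyBdd.add (.const 1)) (fun a s b => by simp; omega)).reverse
  convert h using 2 with a
  have key : ∀ (l : List β) (s : List γ),
      l.foldl (fun s b => f a b :: s) s = (l.map (f a)).reverse ++ s := by
    intro l
    induction l with
    | nil => simp
    | cons b l ih => intro s; simp [ih]
  simp [key]

theorem takeWhile {l : α → List β} {p : α → β → Bool} (hl : PolyTime l)
    (hp : PolyTime fun x : α × β => p x.1 x.2) : PolyTime fun a => (l a).takeWhile (p a) := by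
  have hstep : PolyTime fun x : α × (Bool × List β) × β =>
      if x.2.1.1 && p x.1 x.2.2 then (true, x.2.2 :: x.2.1.2) else (false, x.2.1.2) :=
    ((id.snd.fst.fst).and (hp.comp (id.fst.pair id.snd.snd))).cond
      ((const true).pair (id.snd.snd.cons id.snd.fst.snd)) ((const false).pair id.snd.fst.snd)
  have h := (foldl_of_growth (step := fun (a : α) (s : Bool × List β) (b : β) =>
      if s.1 && p a b then (true, b :: s.2) else (false, s.2)) hl (const (true, [])) hstep
    (G := fun x => sz x + 3) (.add .sz (.const 3)) (fun a s b => by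
      obtain ⟨s₁, s₂⟩ := s
      have := one_le_sz s₁
      have := sz_bool_le true
      have := sz_bool_le false
      split_ifs <;> simp [sz_pair] <;> omega)).snd.reverse
  convert h using 2 with a
  have key0 : ∀ (l s : List β), (l.foldl (fun (s : Bool × List β) (b : β) =>
      if s.1 && p a b then (true, b :: s.2) else (false, s.2)) (false, s)).2 = s := by
    intro l
    induction l with
    | nil => simp
    | cons b l ih => intro s; simpa using ih s
  have key : ∀ (l s : List β), (l.foldl (fun (s : Bool × List β) (b : β) =>
      if s.1 && p a b then (true, b :: s.2) else (false, s.2)) (true, s)).2 =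
        (l.takeWhile (p a)).reverse ++ s := by
    intro l
    induction l with
    | nil => simp
    | cons b l ih =>
      intro s
      cases hb : p a b with
      | true => simp [hb, ih, -Bool.and_eq_true]
      | false => simpa [hb] using key0 l s
  rw [key, List.append_nil, List.reverse_reverse]

theorem range {n : α → ℕ} (hn : PolyTime n) : PolyTime fun a => List.range (n a) := by
  have key : ∀ k, (List.replicate k ()).foldl (fun (s : List ℕ) (_ : Unit) => s.length :: s) [] =
      (List.range k).reverse := by
    intro k
    induction k with
    | zero => rfl
    | succ k ih => rw [List.replicate_succ', List.foldl_append, ih]; simp [List.range_succ]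
  have h := (foldl (step := fun (_ : α) (s : List ℕ) (_ : Unit) => s.length :: s)
    (B := fun a => sz (n a) * (sz (n a) + 1) + 1) hn.replicate
    (const []) (id.snd.fst.length.cons id.snd.fst)
    ((hn.polyBdd.mul (hn.polyBdd.add (.const 1))).add (.const 1)) ?_).reverse
  · convert h using 2 with a
    rw [key, List.reverse_reverse]
  · intro a l' hl'
    have h1 : l' = List.replicate l'.length () := List.eq_replicate_of_mem fun _ _ => rfl
    have h2 := hl'.length_le
    rw [List.length_replicate] at h2
    rw [h1, key, sz_reverse]
    refine (sz_list_le (M := sz (n a)) fun b hb => ?_).trans ?_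
    · rw [List.mem_range] at hb
      simp only [sz_nat]; omega
    · rw [List.length_range]
      gcongr
      simp only [sz_nat]; omega

end PolyTime

end

/-! ### Self-delimiting strings -/

theorem sz_concat_le (a b : Bits) : sz (concat a b) ≤ 5 * sz a + sz b + 1 := by
  induction a with
  | nil =>
    have : sz false = 1 := rfl
    simp only [concat, sz_list_cons, sz_list_nil]
    omega
  | cons x a ih =>
    have := sz_bool_le true
    simp only [concat, sz_list_cons]
    omega

theorem length_concat (a b : Bits) : (concat a b).length = 2 * a.length + b.length + 1 := by
  induction a with
  | nil => simp [concat]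
  | cons x a ih => simp only [concat, List.length_cons, ih]; omega

theorem concat_injective {a b a' b' : Bits} (h : concat a b = concat a' b') : a = a' ∧ b = b' := by
  induction a generalizing a' with
  | nil => cases a' <;> simp_all [concat]
  | cons x a ih =>
    cases a' with
    | nil => simp [concat] at h
    | cons x' a' =>
      simp only [concat, List.cons.injEq, true_and] at h
      have := ih h.2
      simp [h.1, this]

theorem concat_append (a b c : Bits) : concat a (b ++ c) = concat a b ++ c := by
  induction a with
  | nil => rfl
  | cons x a ih => simp [concat, ih]

/-- One step in reading a string of the form `concat a b`: a bit of `a` is moved to the front of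
the accumulator. -/
def unconcatStep (s : Bits × Bits) : Bits × Bits :=
  if s.2.headD false then (s.2.tail.headD false :: s.1, s.2.tail.tail) else s

/-- The inverse of `concat`, except that the first component is reversed. The string itself serves
as a counter: it is at least as long as the number of steps needed. -/
def unconcat (g : Bits) : Bits × Bits :=
  let s := g.foldl (fun s _ => unconcatStep s) ([], g)
  (s.1, s.2.tail)

theorem unconcat_concat (a b : Bits) : unconcat (concat a b) = (a.reverse, b) := by
  have hfix : ∀ (l acc : Bits), l.foldl (fun s _ => unconcatStep s) (acc, false :: b) =
      (acc, false :: b) := by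
    intro l
    induction l with
    | nil => simp
    | cons x l ih => intro acc; simpa [unconcatStep] using ih acc
  have key : ∀ (a l acc : Bits), a.length ≤ l.length →
      l.foldl (fun s _ => unconcatStep s) (acc, concat a b) = (a.reverse ++ acc, false :: b) := by
    intro a
    induction a with
    | nil => intro l acc _; simpa [concat] using hfix l acc
    | cons x a ih =>
      intro l acc hl
      cases l with
      | nil => simp at hl
      | cons y l =>
        have := ih l (x :: acc) (by simpa using hl)
        simpa [concat, unconcatStep] using this
  simp [unconcat, key a (concat a b) [] (by rw [length_concat]; omega)]

theorem enc_false : enc false = .nil := rfl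

theorem enc_bits_nil : enc ([] : Bits) = .nil := rfl

section

variable {α : Type} [Enc α]

namespace PolyTime

theorem concat {f g : α → Bits} (hf : PolyTime f) (hg : PolyTime g) :
    PolyTime fun a => concat (f a) (g a) := by
  have h := foldl_of_growth (step := fun (_ : α) (s : Bits) (b : Bool) => true :: b :: s)
    hf.reverse ((const false).cons hg) ((const true).cons (id.snd.snd.cons id.snd.fst))
    (G := fun _ => 8) (.const 8) (fun a s b => by
      have := sz_bool_le true; have := sz_bool_le b; simp only [sz_list_cons]; omega)
  convert h using 2 with a
  rw [List.foldl_reverse]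
  induction f a with
  | nil => rfl
  | cons x l ih => simp [LightClient.concat, ih]

theorem leafString {e : α → Entry} (he : PolyTime e) : PolyTime fun a => leafString (e a) :=
  he.fst.concat he.snd

theorem unconcat {g : α → Bits} (hg : PolyTime g) : PolyTime fun a => unconcat (g a) := by
  have hstep : PolyTime fun s : Bits × Bits => unconcatStep s :=
    (id.snd.headD enc_false).cond ((id.snd.tail.headD enc_false).cons id.fst |>.pair
      id.snd.tail.tail) id
  have h := foldl_of_growth (step := fun (_ : α) (s : Bits × Bits) (_ : Bool) => unconcatStep s)
    hg ((const []).pair hg) (hstep.comp id.snd.fst) (G := fun _ => 4) (.const 4) (fun a s b => by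
      obtain ⟨s₁, s₂⟩ := s
      simp only [unconcatStep]
      split_ifs with h
      · have h1 : ∀ l : Bits, sz l.tail ≤ sz l := by
          intro l; cases l <;> simp; omega
        have := h1 s₂
        have := h1 s₂.tail
        have := sz_bool_le (s₂.tail.headD false)
        simp only [sz_pair, sz_list_cons]; omega
      · omega)
  exact h.fst.pair h.snd.tail

end PolyTime

end

/-! ### Strings hashed in Merkle trees and in Merkle proofs -/

/-- One step of `climbStr`; the state consists of the current string and the remaining directions,
and `y` is the sibling of the hash of that string. -/
def climbStep (H : Bits → Bits) (s : Bits × List Bool) (y : Bits) : Bits × List Bool :=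
  if s.2.isEmpty then s
  else (if s.2.headD false then concat y (H s.1) else concat (H s.1) y, s.2.tail)

/-- The string that is hashed last when one starts from the string `x` and climbs along the Merkle
proof `π` for as long as there are directions in `d` (`true`: from a right child). -/
def climbStr (H : Bits → Bits) (d : List Bool) (π : List Bits) (x : Bits) : Bits :=
  (π.foldl (climbStep H) (x, d)).1

/-- The string that is hashed at the node with number `m` at height `t` above the list `D` in
which the leaves are numbered from `0`. -/
def honestString (H : Bits → Bits) (D : List Entry) : ℕ → ℕ → Bits
  | 0, m => leafString (D.getD m ([], []))
  | t + 1, m => concat (H (honestString H D t (2 * m))) (H (honestString H D t (2 * m + 1)))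

/-- The tree of height `q` above the entries of `D` with indices from `m * 2 ^ q` on. -/
def subtree (D : List Entry) : ℕ → ℕ → MerkleTree
  | 0, m => .leaf (D.getD m ([], []))
  | q + 1, m => .node (subtree D q (2 * m)) (subtree D q (2 * m + 1))

/-- The concatenations of the first and second, the third and fourth, … string of a list. -/
def pairs : List Bits → List Bits
  | a :: b :: l => concat a b :: pairs l
  | _ => []

/-- All strings that are hashed at height `t` above the list `D`. -/
def levelStrings (H : Bits → Bits) (D : List Entry) : ℕ → List Bits
  | 0 => D.map leafString
  | t + 1 => pairs ((levelStrings H D t).map H)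

theorem climbStr_nil_left (H : Bits → Bits) (π : List Bits) (x : Bits) :
    climbStr H [] π x = x := by
  unfold climbStr
  induction π with
  | nil => rfl
  | cons y π ih => simpa [climbStep] using ih

theorem climbStr_cons (H : Bits → Bits) (b : Bool) (d : List Bool) (y : Bits) (π : List Bits)
    (x : Bits) : climbStr H (b :: d) (y :: π) x =
      climbStr H d π (if b then concat y (H x) else concat (H x) y) := by
  simp [climbStr, climbStep]

theorem climbStr_append_right (H : Bits → Bits) {d : List Bool} {π : List Bits} (π' : List Bits)
    (x : Bits) (h : d.length ≤ π.length) : climbStr H d (π ++ π') x = climbStr H d π x := by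
  induction d generalizing π x with
  | nil => simp [climbStr_nil_left]
  | cons b d ih =>
    cases π with
    | nil => simp at h
    | cons y π =>
      rw [List.cons_append, climbStr_cons, climbStr_cons, ih _ (by simpa using h)]

theorem climbStr_concat (H : Bits → Bits) {d : List Bool} {π : List Bits} (b : Bool) (y x : Bits)
    (h : d.length = π.length) : climbStr H (d ++ [b]) (π ++ [y]) x =
      if b then concat y (H (climbStr H d π x)) else concat (H (climbStr H d π x)) y := by
  induction d generalizing π x with
  | nil =>
    cases π with
    | nil => simp [climbStr_cons, climbStr_nil_left]
    | cons => simp at h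
  | cons b d ih =>
    cases π with
    | nil => simp at h
    | cons y π =>
      rw [List.cons_append, List.cons_append, climbStr_cons, climbStr_cons,
        ih _ (by simpa using h)]

theorem climb_append_singleton (H : Bits → Bits) (π : List Bits) (y : Bits) (i : ℕ) (h : Bits) :
    climb H (π ++ [y]) i h = if i / 2 ^ π.length % 2 = 0 then H (concat (climb H π i h) y)
      else H (concat y (climb H π i h)) := by
  induction π generalizing i h with
  | nil => simp [climb]
  | cons z π ih =>
    simp only [List.cons_append, climb, ih, List.length_cons, pow_succ', Nat.div_div_eq_div_mul]

/-- Only the last `π.length` binary digits of the index matter in climbing. -/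
theorem climb_add_mul (H : Bits → Bits) (π : List Bits) (i c : ℕ) (h : Bits) :
    climb H π (i + 2 ^ π.length * c) h = climb H π i h := by
  induction π generalizing i h with
  | nil => rfl
  | cons z π ih =>
    have h1 : (i + 2 ^ (z :: π).length * c) / 2 = i / 2 + 2 ^ π.length * c := by
      rw [List.length_cons, pow_succ', mul_assoc, Nat.add_mul_div_left _ _ two_pos]
    have h2 : (i + 2 ^ (z :: π).length * c) % 2 = i % 2 := by
      rw [List.length_cons, pow_succ', mul_assoc, Nat.add_mul_mod_self_left]
    simp only [climb, h1, h2, ih]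

theorem exists_hash_climbStr_eq_climb (H : Bits → Bits) (π : List Bits) (i : ℕ) (x : Bits) :
    ∃ d : List Bool, d.length = π.length ∧ H (climbStr H d π x) = climb H π i (H x) := by
  induction π generalizing i x with
  | nil => exact ⟨[], rfl, rfl⟩
  | cons y π ih =>
    obtain ⟨d, hd, h⟩ := ih (i / 2) (if i % 2 = 0 then concat (H x) y else concat y (H x))
    refine ⟨decide (i % 2 ≠ 0) :: d, by simp [hd], ?_⟩
    rw [climbStr_cons, climb]
    by_cases h0 : i % 2 = 0 <;> simpa [h0] using h

theorem root_subtree (H : Bits → Bits) (D : List Entry) (q m : ℕ) :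
    (subtree D q m).root H = H (honestString H D q m) := by
  induction q generalizing m with
  | zero => rfl
  | succ q ih => simp only [subtree, MerkleTree.root, ih, honestString]

theorem leaves_subtree (D : List Entry) (q m : ℕ) : (subtree D q m).leaves = 2 ^ q := by
  induction q generalizing m with
  | zero => rfl
  | succ q ih => simp only [subtree, MerkleTree.leaves, ih]; ring

/-- The trees of a mountain range, and all their subtrees, are aligned: a tree of height `q`
begins at a multiple of `2 ^ q`. Hence they are determined by a height and a number. -/
theorem make_eq_subtree (D : List Entry) (q m : ℕ) :
    MerkleTree.make q ((D.drop (m * 2 ^ q)).take (2 ^ q)) = subtree D q m := by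
  induction q generalizing m with
  | zero => simp [MerkleTree.make, subtree, List.headD_eq_head?_getD, List.head?_take]
  | succ q ih =>
    rw [MerkleTree.make, subtree, ← ih, ← ih, List.take_take, List.drop_take, List.drop_drop]
    congr 3
    · rw [min_eq_left (Nat.pow_le_pow_right two_pos q.le_succ)]
    · ring_nf
    · rw [pow_succ]; omega
    · ring_nf

theorem length_pairs_le (l : List Bits) : (pairs l).length ≤ l.length := by
  induction l using pairs.induct with
  | case1 a b l ih => simp only [pairs, List.length_cons]; omega
  | case2 l h =>
    rw [pairs]
    · simp
    · exact h

theorem getElem?_pairs {l : List Bits} {n : ℕ} {a b : Bits} (ha : l[2 * n]? = some a)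
    (hb : l[2 * n + 1]? = some b) : (pairs l)[n]? = some (concat a b) := by
  induction l using pairs.induct generalizing n with
  | case1 x y l ih =>
    cases n with
    | zero => simp at ha hb; simp [pairs, ha, hb]
    | succ n =>
      have h1 : 2 * (n + 1) = 2 * n + 1 + 1 := by ring
      rw [h1] at ha hb
      simp only [List.getElem?_cons_succ] at ha hb
      simpa [pairs] using ih ha hb
  | case2 l h =>
    exfalso
    match l with
    | [] => simp at ha
    | [x] => simp at hb
    | x :: y :: l => exact h x y l rfl

theorem honestString_mem_levelStrings (H : Bits → Bits) {D : List Entry} {t n : ℕ}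
    (h : (n + 1) * 2 ^ t ≤ D.length) : honestString H D t n ∈ levelStrings H D t := by
  suffices (levelStrings H D t)[n]? = some (honestString H D t n) from List.mem_of_getElem? this
  induction t generalizing n with
  | zero =>
    have h' : n < D.length := by omega
    simp [levelStrings, honestString, h']
  | succ t ih =>
    rw [pow_succ] at h
    apply getElem?_pairs
    · rw [List.getElem?_map, ih]
      · rfl
      · nlinarith [Nat.zero_le (2 ^ t)]
    · rw [List.getElem?_map, ih]
      · rfl
      · nlinarith

/-! ### Merkle proofs are binding -/

theorem leafString_injective : Function.Injective leafString := fun e e' h => by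
  have := concat_injective h
  exact Prod.ext this.1 this.2

/-- Climbing along the Merkle proof `π` from the string `x`, in the directions `d`, leads to a
string that collides with one that is hashed at the same height above `D`. -/
def HonestCollision (H : Bits → Bits) (D : List Entry) (d : List Bool) (π : List Bits) (x : Bits) :
    Prop :=
  d.length ≤ π.length ∧ ∃ n, (n + 1) * 2 ^ d.length ≤ D.length ∧
    climbStr H d π x ≠ honestString H D d.length n ∧
    H (climbStr H d π x) = H (honestString H D d.length n)

theorem HonestCollision.append {H : Bits → Bits} {D : List Entry} {d : List Bool} {π : List Bits}
    {x : Bits} (h : HonestCollision H D d π x) (π' : List Bits) :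
    HonestCollision H D d (π ++ π') x := by
  obtain ⟨hd, h⟩ := h
  rw [← climbStr_append_right H π' x hd] at h
  exact ⟨by rw [List.length_append]; omega, h⟩

/-- Two ways up that start from different strings and end with the same hash contain a collision:
at the first height at which the hashes agree. -/
theorem exists_collision_of_climb_eq (H : Bits → Bits) (D : List Entry) (π : List Bits)
    {t i m : ℕ} {x : Bits} (hi : i < 2 ^ π.length)
    (h : climb H π i (H x) = H (honestString H D (t + π.length) m))
    (hx : x ≠ honestString H D t (m * 2 ^ π.length + i)) :
    ∃ (d : List Bool) (n : ℕ), d.length ≤ π.length ∧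
      (n + 1) * 2 ^ d.length ≤ (m + 1) * 2 ^ π.length ∧
      climbStr H d π x ≠ honestString H D (t + d.length) n ∧
      H (climbStr H d π x) = H (honestString H D (t + d.length) n) := by
  induction π generalizing t i x with
  | nil =>
    have h0 : i = 0 := by simpa using hi
    subst h0
    refine ⟨[], m, by simp, by simp, ?_, ?_⟩
    · simpa [climbStr_nil_left] using hx
    · simpa [climbStr_nil_left, climb] using h
  | cons y π ih =>
    rw [List.length_cons, pow_succ] at *
    set N := m * (2 ^ π.length * 2) + i with hN
    by_cases hc : H x = H (honestString H D t N)
    · refine ⟨[], N, by simp, ?_, by simpa [climbStr_nil_left] using hx,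
        by simpa [climbStr_nil_left] using hc⟩
      simp only [List.length_nil, pow_zero, mul_one]
      rw [hN]
      nlinarith
    · have hN2 : N / 2 = m * 2 ^ π.length + i / 2 := by
        rw [hN, ← mul_assoc, mul_comm _ 2, Nat.mul_add_div two_pos]
      have hmod : N % 2 = i % 2 := by
        rw [hN, ← mul_assoc, Nat.mul_add_mod']
      obtain ⟨d, n, h0, h1, h2, h3⟩ := ih (t := t + 1) (i := i / 2)
        (x := if i % 2 = 0 then concat (H x) y else concat y (H x)) (by omega)
        (by
          rw [climb] at h
          rw [show t + 1 + π.length = t + (π.length + 1) by ring, ← h]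
          split_ifs <;> rfl)
        (by
          rw [← hN2, honestString]
          intro heq
          apply hc
          split_ifs at heq with h0
          · rw [(concat_injective heq).1, show 2 * (N / 2) = N by omega]
          · rw [(concat_injective heq).2, show 2 * (N / 2) + 1 = N by omega])
      have hdir : climbStr H (decide (i % 2 ≠ 0) :: d) (y :: π) x =
          climbStr H d π (if i % 2 = 0 then concat (H x) y else concat y (H x)) := by
        rw [climbStr_cons]
        by_cases h0 : i % 2 = 0 <;> simp [h0]
      refine ⟨decide (i % 2 ≠ 0) :: d, n, by simpa using h0, ?_, ?_, ?_⟩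
      · rw [List.length_cons, pow_succ]; nlinarith
      · rw [hdir, List.length_cons, show t + (d.length + 1) = t + 1 + d.length by ring]
        exact h2
      · rw [hdir, List.length_cons, show t + (d.length + 1) = t + 1 + d.length by ring]
        exact h3

theorem eq_or_honestCollision (H : Bits → Bits) (D : List Entry) (π : List Bits)
    {i m : ℕ} {e : Entry} (hi : i < 2 ^ π.length) (hm : (m + 1) * 2 ^ π.length ≤ D.length)
    (h : climb H π i (H (leafString e)) = H (honestString H D π.length m)) :
    e = D.getD (m * 2 ^ π.length + i) ([], []) ∨
      ∃ d, HonestCollision H D d π (leafString e) := by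
  by_cases he : e = D.getD (m * 2 ^ π.length + i) ([], [])
  · exact .inl he
  · obtain ⟨d, n, h0, h1, h2, h3⟩ := exists_collision_of_climb_eq H D π (t := 0) hi
      (by simpa using h) (fun h => he (leafString_injective h))
    rw [zero_add] at h2 h3
    exact .inr ⟨d, h0, n, h1.trans hm, h2, h3⟩

/-- The peaks `ps`, the first of which is alleged to begin at index `off`, are the roots of the
corresponding trees above `D`. -/
def Matches (H : Bits → Bits) (D : List Entry) : ℕ → List Peak → Prop
  | _, [] => True
  | off, (q, h) :: ps => (∃ m, off = m * 2 ^ q ∧ off + 2 ^ q ≤ D.length ∧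
      h = H (honestString H D q m)) ∧ Matches H D (off + 2 ^ q) ps

theorem totalLeaves_cons (p : Peak) (ps : List Peak) :
    totalLeaves (p :: ps) = 2 ^ p.1 + totalLeaves ps := by
  simp [totalLeaves]

theorem verifyEntry_append (H : Bits → Bits) (π : List Bits) (ps ps' : List Peak) (j : ℕ)
    (e : Entry) : verifyEntry H π (ps ++ ps') j e =
      if j < totalLeaves ps then verifyEntry H π ps j e
      else verifyEntry H π ps' (j - totalLeaves ps) e := by
  induction ps generalizing j with
  | nil => simp [totalLeaves]
  | cons p ps ih =>
    obtain ⟨q, h⟩ := p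
    rw [List.cons_append, verifyEntry, verifyEntry, ih, totalLeaves_cons]
    by_cases h1 : j < 2 ^ q
    · simp [h1, show j < 2 ^ q + totalLeaves ps by omega]
    · by_cases h2 : j - 2 ^ q < totalLeaves ps
      · simp [h1, h2, show j < 2 ^ q + totalLeaves ps by omega]
      · simp [h1, h2, show ¬ j < 2 ^ q + totalLeaves ps by omega, Nat.sub_add_eq]

theorem eq_or_honestCollision_of_verifyEntry {H : Bits → Bits} {D : List Entry} {π : List Bits}
    {ps : List Peak} {off j : ℕ} {e : Entry} (hps : Matches H D off ps)
    (h : verifyEntry H π ps j e = true) :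
    e = D.getD (off + j) ([], []) ∨ ∃ d, HonestCollision H D d π (leafString e) := by
  induction ps generalizing off j with
  | nil => simp [verifyEntry] at h
  | cons p ps ih =>
    obtain ⟨q, r⟩ := p
    obtain ⟨⟨m, rfl, hm, rfl⟩, hps⟩ := hps
    rw [verifyEntry] at h
    split_ifs at h with hj
    · simp only [verifyTree, Bool.and_eq_true, beq_iff_eq] at h
      obtain ⟨rfl, h⟩ := h
      exact eq_or_honestCollision H D π hj (by rw [add_mul, one_mul]; exact hm) h
    · convert ih hps h using 3
      omega

/-! ### The bisection game -/

theorem pathIndex_cons (b : Bool) (p : List Bool) :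
    Verifier.pathIndex (b :: p) = b.toNat * 2 ^ p.length + Verifier.pathIndex p := by
  have key : ∀ (p : List Bool) (n : ℕ), p.foldl (fun n b => 2 * n + b.toNat) n =
      n * 2 ^ p.length + p.foldl (fun n b => 2 * n + b.toNat) 0 := by
    intro p
    induction p with
    | nil => simp
    | cons b p ih =>
      intro n
      rw [List.foldl_cons, ih, List.foldl_cons, ih (2 * 0 + _), List.length_cons]
      ring
  rw [Verifier.pathIndex, List.foldl_cons, key]
  simp [Verifier.pathIndex]

/-- The string hashed when the responder opens the node at the path `p` collides with the one that
is reached by climbing along the Merkle proof `π` from the string `x`, in the directions `d`. -/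
def OpenedCollision (H : Bits → Bits) (answer : List Bool → Option (Bits × Bits)) (d p : List Bool)
    (π : List Bits) (x : Bits) : Prop :=
  ∃ hl hr, answer p = some (hl, hr) ∧ climbStr H d π x ≠ concat hl hr ∧
    H (climbStr H d π x) = H (concat hl hr)

/-- The descent from a wrong root leads to a wrong leaf, while the leaf before it is determined by
the responder's hashes up to collisions: at the node where the paths to these two leaves separate,
the challenger has gone right, so that the left children agree. -/
theorem descend_eq_some {V : Verifier} {D : List Entry} {answer : List Bool → Option (Bits × Bits)}
    {q m : ℕ} {h h' : Bits} {path path' : List Bool} (hm : (m + 1) * 2 ^ q ≤ D.length)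
    (hd : V.descend answer q (subtree D q m) h path = some (path', h'))
    (hroot : V.H (honestString V.H D q m) ≠ h) :
    ∃ p, path' = path ++ p ∧ p.length = q ∧ Verifier.pathIndex p < 2 ^ q ∧
      V.H (leafString (D.getD (m * 2 ^ q + Verifier.pathIndex p) ([], []))) ≠ h' ∧
      ∀ (e : Entry) (π : List Bits), π.length = q → 1 ≤ Verifier.pathIndex p →
        climb V.H π (Verifier.pathIndex p - 1) (V.H (leafString e)) = h →
        e = D.getD (m * 2 ^ q + Verifier.pathIndex p - 1) ([], []) ∨
        (∃ d, HonestCollision V.H D d π (leafString e)) ∨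
        ∃ d p', d.length ≤ q ∧ p'.length ≤ q ∧
          OpenedCollision V.H answer d (path ++ p') π (leafString e) := by
  induction q generalizing m h path with
  | zero =>
    simp only [Verifier.descend, Option.some.injEq, Prod.mk.injEq] at hd
    obtain ⟨rfl, rfl⟩ := hd
    exact ⟨[], by simp, rfl, by simp [Verifier.pathIndex],
      by simpa [Verifier.pathIndex, honestString] using hroot,
      fun e π _ h1 => by simp [Verifier.pathIndex] at h1⟩
  | succ q ih =>
    rw [Verifier.descend] at hd
    split at hd
    · simp at hd
    rename_i hl hr hans
    have hopen : V.H (concat hl hr) = h := by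
      by_contra hopen
      simp [hopen] at hd
    rw [if_pos hopen] at hd
    -- The climbing string at the top node, if it does not collide with the opened one.
    have key : ∀ (i : ℕ) (e : Entry) (π : List Bits), π.length = q + 1 →
        climb V.H π i (V.H (leafString e)) = h →
        (∃ d, d.length ≤ q + 1 ∧ OpenedCollision V.H answer d path π (leafString e)) ∨
        ∃ π₁ y, π = π₁ ++ [y] ∧ π₁.length = q ∧ climb V.H π₁ i (V.H (leafString e)) =
          if i / 2 ^ q % 2 = 0 then hl else hr := by
      intro i e π hπ hcl
      obtain ⟨π₁, y, rfl⟩ : ∃ π₁ y, π = π₁ ++ [y] := by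
        have hne : π ≠ [] := by rintro rfl; simp at hπ
        exact ⟨π.dropLast, π.getLast hne, (List.dropLast_append_getLast hne).symm⟩
      have hπ₁ : π₁.length = q := by simpa using hπ
      obtain ⟨d, hdl, hds⟩ := exists_hash_climbStr_eq_climb V.H π₁ i (leafString e)
      have htop := climbStr_concat V.H (decide (i / 2 ^ q % 2 ≠ 0)) y (leafString e) hdl
      rw [climb_append_singleton, hπ₁] at hcl
      by_cases hstr : climbStr V.H (d ++ [decide (i / 2 ^ q % 2 ≠ 0)]) (π₁ ++ [y]) (leafString e) =
          concat hl hr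
      · refine .inr ⟨π₁, y, rfl, hπ₁, ?_⟩
        rw [← hds]
        rw [htop] at hstr
        by_cases h0 : i / 2 ^ q % 2 = 0
        · simp only [h0] at hstr ⊢
          exact (concat_injective hstr).1
        · simp only [h0, ne_eq, not_false_eq_true, decide_true, if_true] at hstr
          simp only [h0, if_false]
          exact (concat_injective hstr).2
      · refine .inl ⟨_, by simp [hdl, hπ₁], hl, hr, hans, hstr, ?_⟩
        rw [hopen, ← hcl, htop, hds]
        by_cases h0 : i / 2 ^ q % 2 = 0 <;> simp [h0]
    have hpow : 2 ^ (q + 1) = 2 ^ q * 2 := pow_succ 2 q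
    have hposq : 0 < 2 ^ q := by positivity
    split_ifs at hd with hq
    · -- The left children agree, so the right children do not.
      have hl' : V.H (honestString V.H D q (2 * m)) = hl := by
        simpa [Verifier.nextQuery, subtree, MerkleTree.left, root_subtree] using hq
      obtain ⟨p, rfl, hp, hlt, hleaf, hprev⟩ := ih (m := 2 * m + 1) (by rw [hpow] at hm; nlinarith)
        hd (by
          intro hr'
          apply hroot
          rw [← hopen, honestString, hl', hr'])
      refine ⟨true :: p, by simp, by simp [hp], ?_, ?_, ?_⟩
      · rw [pathIndex_cons, hp, hpow]; simp; omega
      · rw [pathIndex_cons, hp, hpow]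
        have : m * (2 ^ q * 2) + ((true).toNat * 2 ^ q + Verifier.pathIndex p) =
            (2 * m + 1) * 2 ^ q + Verifier.pathIndex p := by
          rw [Bool.toNat_true]; ring
        rwa [this]
      · intro e π hπ h1 hcl
        rw [pathIndex_cons, hp] at h1 hcl ⊢
        simp only [Bool.toNat_true, one_mul] at h1 hcl ⊢
        rcases key _ e π hπ hcl with ⟨d, hd1, hd2⟩ | ⟨π₁, y, rfl, hπ₁, hπc⟩
        · exact .inr (.inr ⟨d, [], hd1, by simp, by simpa using hd2⟩)
        · by_cases h0 : Verifier.pathIndex p = 0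
          · have hdiv : (2 ^ q + Verifier.pathIndex p - 1) / 2 ^ q % 2 = 0 := by
              rw [h0, Nat.div_eq_of_lt (by omega)]
            rw [hdiv, if_pos rfl, ← hl'] at hπc
            rw [← hπ₁] at hπc hm
            rcases eq_or_honestCollision V.H D π₁ (by rw [h0, hπ₁]; omega)
              (by rw [pow_succ] at hm; nlinarith) hπc with he | ⟨d, hd⟩
            · left
              rw [he, hπ₁, hpow]
              congr 1
              have : 2 * m * 2 ^ q = m * (2 ^ q * 2) := by ring
              omega
            · exact .inr (.inl ⟨d, hd.append _⟩)
          · have hdiv : (2 ^ q + Verifier.pathIndex p - 1) / 2 ^ q % 2 = 1 := by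
              rw [show 2 ^ q + Verifier.pathIndex p - 1 = (Verifier.pathIndex p - 1) + 2 ^ q by omega,
                Nat.add_div_right _ hposq, Nat.div_eq_of_lt (by omega)]
            rw [hdiv, if_neg one_ne_zero,
              show 2 ^ q + Verifier.pathIndex p - 1 = (Verifier.pathIndex p - 1) + 2 ^ q * 1 by omega,
              ← hπ₁, climb_add_mul] at hπc
            rcases hprev e π₁ hπ₁ (by omega) hπc with he | ⟨d, hd⟩ | ⟨d, p', hd, hp', hdp⟩
            · left
              rw [he, hpow]
              congr 1
              have : (2 * m + 1) * 2 ^ q = m * (2 ^ q * 2) + 2 ^ q := by ring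
              omega
            · exact .inr (.inl ⟨d, hd.append _⟩)
            · refine .inr (.inr ⟨d, true :: p', by omega, by simp; omega, ?_⟩)
              obtain ⟨a, b, h1, h2, h3⟩ := hdp
              refine ⟨a, b, by simpa using h1, ?_⟩
              rw [climbStr_append_right _ _ _ (by omega)]
              exact ⟨h2, h3⟩
    · -- The left children disagree.
      have hl' : V.H (honestString V.H D q (2 * m)) ≠ hl := by
        simpa [Verifier.nextQuery, subtree, MerkleTree.left, root_subtree] using hq
      obtain ⟨p, rfl, hp, hlt, hleaf, hprev⟩ := ih (m := 2 * m) (by rw [hpow] at hm; nlinarith)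
        hd hl'
      have hidx : (false).toNat * 2 ^ q + Verifier.pathIndex p = Verifier.pathIndex p := by simp
      have hmul : 2 * m * 2 ^ q = m * (2 ^ q * 2) := by ring
      refine ⟨false :: p, by simp, by simp [hp], ?_, ?_, ?_⟩
      · rw [pathIndex_cons, hp, hpow, hidx]; omega
      · rw [pathIndex_cons, hp, hpow, hidx, ← hmul]
        exact hleaf
      · intro e π hπ h1 hcl
        rw [pathIndex_cons, hp, hidx] at h1 hcl ⊢
        rcases key _ e π hπ hcl with ⟨d, hd1, hd2⟩ | ⟨π₁, y, rfl, hπ₁, hπc⟩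
        · exact .inr (.inr ⟨d, [], hd1, by simp, by simpa using hd2⟩)
        · have hdiv : (Verifier.pathIndex p - 1) / 2 ^ q % 2 = 0 := by
            rw [Nat.div_eq_of_lt (by omega)]
          rw [hdiv, if_pos rfl] at hπc
          rcases hprev e π₁ hπ₁ h1 hπc with he | ⟨d, hd⟩ | ⟨d, p', hd, hp', hdp⟩
          · left
            rw [he, hpow, hmul]
          · exact .inr (.inl ⟨d, hd.append _⟩)
          · refine .inr (.inr ⟨d, false :: p', by omega, by simp; omega, ?_⟩)
            obtain ⟨a, b, h1, h2, h3⟩ := hdp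
            refine ⟨a, b, by simpa using h1, ?_⟩
            rw [climbStr_append_right _ _ _ (by omega)]
            exact ⟨h2, h3⟩

/-! ### Zooming -/

theorem sum_two_pow_lt {qs : List ℕ} {N : ℕ} (h : qs.Pairwise (· > ·)) (hN : ∀ q ∈ qs, q < N) :
    (qs.map (2 ^ ·)).sum < 2 ^ N := by
  induction qs generalizing N with
  | nil => simp
  | cons q qs ih =>
    rw [List.pairwise_cons] at h
    have h1 := ih h.2 h.1
    have h2 : 2 ^ (q + 1) ≤ 2 ^ N := Nat.pow_le_pow_right two_pos (hN q (by simp))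
    rw [pow_succ] at h2
    simp only [List.map_cons, List.sum_cons]
    omega

theorem length_le_of_pairwise_gt {qs : List ℕ} {N : ℕ} (h : qs.Pairwise (· > ·))
    (hN : ∀ q ∈ qs, q < N) : qs.length ≤ N := by
  induction qs generalizing N with
  | nil => simp
  | cons q qs ih =>
    rw [List.pairwise_cons] at h
    have h1 := ih h.2 h.1
    have h2 := hN q (by simp)
    simp only [List.length_cons]
    omega

theorem heights_pairwise (n : ℕ) : (heights n).Pairwise (· > ·) := by
  rw [heights, List.pairwise_reverse]
  exact Nat.bitIndices_sorted.pairwise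

theorem sum_heights (n : ℕ) : ((heights n).map (2 ^ ·)).sum = n := by
  rw [heights, List.map_reverse, List.sum_reverse]
  exact Nat.sum_map_two_pow_bitIndices n

/-- The peaks have strictly decreasing heights. -/
def Decreasing (ps : List Peak) : Prop := (ps.map Prod.fst).Pairwise (· > ·)

theorem Decreasing.tail {p : Peak} {ps : List Peak} (h : Decreasing (p :: ps)) : Decreasing ps :=
  (List.pairwise_cons.1 h).2

theorem totalLeaves_lt_of_decreasing {p : Peak} {ps : List Peak} (h : Decreasing (p :: ps)) :
    totalLeaves ps < 2 ^ p.1 := by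
  have := sum_two_pow_lt (List.pairwise_cons.1 h).2 (List.pairwise_cons.1 h).1
  rwa [List.map_map] at this

/-- What a result of zooming means, if the peaks `ps`, numbered from `i₀`, are alleged to begin at
index `off`. -/
def Zoom.Correct (H : Bits → Bits) (D : List Entry) (ps : List Peak) (off i₀ : ℕ) : Zoom → Prop
  | .monologue => Matches H D off ps
  | .bisection i T => ∃ ps₁ q h ps₂ m, ps = ps₁ ++ (q, h) :: ps₂ ∧ i = i₀ + ps₁.length ∧
      Matches H D off ps₁ ∧ off + totalLeaves ps₁ = m * 2 ^ q ∧ (m + 1) * 2 ^ q ≤ D.length ∧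
      T = subtree D q m ∧ H (honestString H D q m) ≠ h

theorem Zoom.Correct.cons {H : Bits → Bits} {D : List Entry} {ps : List Peak} {off i₀ q : ℕ}
    {h : Bits} {z : Zoom} (hz : z.Correct H D ps (off + 2 ^ q) (i₀ + 1))
    (hm : ∃ m, off = m * 2 ^ q ∧ off + 2 ^ q ≤ D.length ∧ h = H (honestString H D q m)) :
    z.Correct H D ((q, h) :: ps) off i₀ := by
  cases z with
  | monologue => exact ⟨hm, hz⟩
  | bisection i T =>
    obtain ⟨ps₁, q', h', ps₂, m', rfl, rfl, h1, h2, h3⟩ := hz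
    refine ⟨(q, h) :: ps₁, q', h', ps₂, m', rfl, by simp only [List.length_cons]; omega,
      ⟨hm, h1⟩, ?_, h3⟩
    rw [totalLeaves_cons, ← h2]; ring

theorem treeVsPeaks_correct (H : Bits → Bits) (D : List Entry) {q m i : ℕ} {ps : List Peak}
    (hps : Decreasing ps) (hlt : totalLeaves ps < 2 ^ q)
    (hD : m * 2 ^ q + totalLeaves ps ≤ D.length) :
    (treeVsPeaks H (subtree D q m) ps i).Correct H D ps (m * 2 ^ q) i := by
  induction q generalizing m i ps with
  | zero =>
    cases ps with
    | nil => trivial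
    | cons p ps =>
      rw [totalLeaves_cons] at hlt
      have : 0 < 2 ^ p.1 := by positivity
      omega
  | succ q ih =>
    cases ps with
    | nil => trivial
    | cons p ps =>
      obtain ⟨q', h⟩ := p
      have hmul : m * 2 ^ (q + 1) = 2 * m * 2 ^ q := by rw [pow_succ]; ring
      rw [subtree, treeVsPeaks, leaves_subtree, root_subtree]
      rw [hmul] at hD ⊢
      have hlt' := totalLeaves_lt_of_decreasing hps
      rw [totalLeaves_cons] at hlt hD ⊢
      simp only at hlt hD hlt' ⊢
      by_cases hq : 2 ^ q' + totalLeaves ps < 2 ^ q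
      · rw [if_pos hq]
        exact ih hps (by rwa [totalLeaves_cons]) (by rwa [totalLeaves_cons])
      · rw [if_neg hq]
        -- The number of remaining leaves has exactly `q + 1` binary digits.
        have hqq : q' = q := by
          have h1 : q < q' + 1 := (Nat.pow_lt_pow_iff_right one_lt_two).1 (by rw [pow_succ]; omega)
          have h2 : q' < q + 1 := (Nat.pow_lt_pow_iff_right one_lt_two).1 (by omega)
          omega
        subst hqq
        split_ifs with hroot
        · refine Zoom.Correct.cons ?_ ⟨2 * m, rfl, by omega, hroot.symm⟩
          have hmul' : 2 * m * 2 ^ q' + 2 ^ q' = (2 * m + 1) * 2 ^ q' := by ring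
          rw [hmul']
          exact ih hps.tail hlt' (by omega)
        · exact ⟨[], q', h, ps, 2 * m, rfl, rfl, trivial, by simp [totalLeaves],
            by rw [add_mul]; omega, rfl, hroot⟩

theorem peaksVsPeaks_correct (H : Bits → Bits) (D : List Entry) {hs : List ℕ} {off i : ℕ}
    {ps : List Peak} (hhs : hs.Pairwise (· > ·)) (hps : Decreasing ps)
    (hsum : off + (hs.map (2 ^ ·)).sum = D.length) (hD : off + totalLeaves ps ≤ D.length)
    (hoff : ∀ q ∈ hs, 2 ^ q ∣ off) :
    (peaksVsPeaks H (makeTrees hs (D.drop off)) ps i).Correct H D ps off i := by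
  induction hs generalizing off i ps with
  | nil =>
    cases ps with
    | nil => trivial
    | cons p ps =>
      rw [totalLeaves_cons] at hD
      have : 0 < 2 ^ p.1 := by positivity
      simp at hsum
      omega
  | cons q hs ih =>
    obtain ⟨m, rfl⟩ : ∃ m, off = m * 2 ^ q := by
      obtain ⟨m, hm⟩ := hoff q (by simp)
      exact ⟨m, by rw [hm, mul_comm]⟩
    cases ps with
    | nil => trivial
    | cons p ps =>
      obtain ⟨q', h⟩ := p
      have hlt := sum_two_pow_lt (List.pairwise_cons.1 hhs).2 (List.pairwise_cons.1 hhs).1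
      have hlt' := totalLeaves_lt_of_decreasing hps
      rw [makeTrees, peaksVsPeaks, make_eq_subtree, leaves_subtree, root_subtree, List.drop_drop]
      simp only [List.map_cons, List.sum_cons] at hsum
      rw [totalLeaves_cons] at hD
      simp only at hD hlt' ⊢
      by_cases hq : 2 ^ q = 2 ^ q'
      · rw [if_pos hq]
        obtain rfl : q = q' := Nat.pow_right_injective le_rfl hq
        split_ifs with hroot
        · refine Zoom.Correct.cons ?_ ⟨m, rfl, by omega, hroot.symm⟩
          refine ih (List.pairwise_cons.1 hhs).2 hps.tail (by omega) (by omega) fun q'' hq'' => ?_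
          have : 2 ^ q'' ∣ 2 ^ q :=
            Nat.pow_dvd_pow 2 (le_of_lt ((List.pairwise_cons.1 hhs).1 q'' hq''))
          exact Nat.dvd_add (Dvd.dvd.mul_left this m) this
        · exact ⟨[], q, h, ps, m, rfl, rfl, trivial, by simp [totalLeaves],
            by rw [add_mul]; omega, rfl, hroot⟩
      · rw [if_neg hq]
        refine treeVsPeaks_correct H D hps ?_ (by rw [totalLeaves_cons]; exact hD)
        -- The responder claims at most as many leaves, so its next tree is smaller.
        have h1 : q' < q + 1 := (Nat.pow_lt_pow_iff_right one_lt_two).1 (by rw [pow_succ]; omega)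
        have h2 : q' ≠ q := fun h => hq (by rw [h])
        have h3 : 2 ^ (q' + 1) ≤ 2 ^ q := Nat.pow_le_pow_right two_pos (by omega)
        rw [pow_succ] at h3
        rw [totalLeaves_cons]
        simp only
        omega

/-! ### What a lost challenge game reveals -/

theorem Verifier.checkSuffix_range' (V : Verifier) {D : List Entry} {witness : ℕ → Bits}
    {e : Entry} {s n : ℕ} (hs : 1 ≤ s) (he : e = D.getD (s - 1) ([], []))
    (h : ∀ j, s ≤ j → j < s + n →
      V.checkTransition (D.getD (j - 1) ([], [])) (D.getD j ([], [])) (witness j) = true) :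
    V.checkSuffix e ((List.range' s n).map fun j => (D.getD j ([], []), witness j)) = true := by
  induction n generalizing s e with
  | zero => rfl
  | succ n ih =>
    rw [List.range'_succ, List.map_cons, checkSuffix, he, h s le_rfl (by omega), Bool.true_and]
    exact ih (by omega) rfl fun j h1 h2 => h j (by omega) (by omega)

/-- The final message `o` of the responder in a bisection game, after the query `p` in the tree
with number `i`, is evidence of an attack: of a collision, or of a wrong entry that passes the
check against the correct entry before it. -/
inductive Evidence (V : Verifier) (D : List Entry)
    (openNode : ℕ × List Bool → Option (Bits × Bits)) (i : ℕ) (o : Reveal) : Prop where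
  | honest (d : List Bool) (h : HonestCollision V.H D d o.prevProof (leafString o.prev)) :
      Evidence V D openNode i o
  | opened (d p : List Bool) (hd : 2 ^ d.length ≤ D.length) (hp : 2 ^ p.length ≤ D.length)
      (h : OpenedCollision V.H (fun p => openNode (i, p)) d p o.prevProof (leafString o.prev)) :
      Evidence V D openNode i o
  | transition (j : ℕ) (hj : j + 1 < D.length) (hprev : o.prev = D.getD j ([], []))
      (hentry : o.entry ≠ D.getD (j + 1) ([], []))
      (h : V.checkTransition o.prev o.entry o.transition = true) : Evidence V D openNode i o

theorem HonestCollision.length_le {H : Bits → Bits} {D : List Entry} {d : List Bool}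
    {π : List Bits} {x : Bits} (h : HonestCollision H D d π x) : 2 ^ d.length ≤ D.length := by
  obtain ⟨-, n, h, -⟩ := h
  nlinarith [Nat.zero_le (n * 2 ^ d.length)]

/-- If the honest challenger is able to pass the checks of the suffix monologue, then he loses
only against a responder whose messages yield a hash collision or a wrong transition. -/
theorem Verifier.exists_evidence {V : Verifier} {D : List Entry} {witness : ℕ → Bits} {bound : ℕ}
    {c : Claim} {openNode : ℕ × List Bool → Option (Bits × Bits)}
    {openLeaf : ℕ × List Bool → Option Reveal} (hvalid : c.valid V.H = true)
    (hsize : c.size ≤ D.length) (hgenesis : D.getD 0 ([], []) = ([], V.genesis))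
    (hwitness : ∀ j, c.size ≤ j → j < D.length →
      V.checkTransition (D.getD (j - 1) ([], [])) (D.getD j ([], [])) (witness j) = true)
    (h : ¬ (V.challengeGame D witness bound c openNode openLeaf = .challenger ∨
      V.challengeGame D witness bound c openNode openLeaf = .both)) :
    (∃ d, HonestCollision V.H D d c.proof (leafString c.last)) ∨
      ∃ i p o, i ≤ Nat.log 2 D.length ∧ 2 ^ p.length ≤ D.length ∧ openLeaf (i, p) = some o ∧
        Evidence V D openNode i o := by
  simp only [Claim.valid, Bool.and_eq_true, beq_iff_eq, bne_iff_ne] at hvalid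
  obtain ⟨hlen, hpos, hlast⟩ := hvalid
  have hmap : c.alleged.map Prod.fst = heights c.size := by
    rw [Claim.alleged, List.map_fst_zip]; omega
  have hdec : Decreasing c.alleged := by rw [Decreasing, hmap]; exact heights_pairwise _
  have htotal : totalLeaves c.alleged = c.size := by
    conv_rhs => rw [← sum_heights c.size, ← hmap, List.map_map]
    rfl
  have hzoom : (peaksVsPeaks V.H (makeMMR D) c.alleged 0).Correct V.H D c.alleged 0 0 :=
    peaksVsPeaks_correct V.H D (hs := heights D.length) (off := 0) (heights_pairwise _) hdec
      (by rw [zero_add, sum_heights]) (by omega) (by simp)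
  rw [challengeGame] at h
  generalize peaksVsPeaks V.H (makeMMR D) c.alleged 0 = z at h hzoom
  cases z with
  | monologue =>
    rcases eq_or_honestCollision_of_verifyEntry hzoom hlast with he | he
    · exfalso
      apply h
      simp only [suffixMonologue]
      rw [checkSuffix_range' V (by omega) (by simpa using he)
        fun j h1 h2 => hwitness j h1 (by omega), if_pos rfl]
      split_ifs <;> simp
    · exact .inl he
  | bisection i T =>
    right
    obtain ⟨ps₁, q, r, ps₂, m, hps, rfl, hmatch, hoff, hm, rfl, hne⟩ := hzoom
    rw [zero_add] at hoff
    have hq : 2 ^ q ≤ D.length := by nlinarith [Nat.zero_le (m * 2 ^ q)]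
    have hget : c.alleged[ps₁.length]? = some (q, r) := by simp [hps]
    have htake : c.alleged.take ps₁.length = ps₁ := by simp [hps]
    simp only [bisectionGame, zero_add, hget, htake] at h
    split at h
    · simp at h
    rename_i path h' hdesc
    split at h
    · simp at h
    rename_i o hopen
    split_ifs at h with hcheck
    · clear h
      obtain ⟨p, hpath, hp, hlt, hleaf, hprev⟩ := descend_eq_some hm hdesc hne
      obtain rfl : path = p := hpath
      refine ⟨ps₁.length, _, o, ?_, by rw [hp]; exact hq, hopen, ?_⟩
      · have h1 := length_le_of_pairwise_gt (heights_pairwise c.size)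
          (N := Nat.log 2 D.length + 1) fun q hq => by
            have : 2 ^ q ≤ c.size := Nat.two_pow_le_of_mem_bitIndices (by simpa [heights] using hq)
            exact Nat.lt_succ_of_le (Nat.le_log_of_pow_le one_lt_two (by omega))
        rw [← hmap, List.length_map, hps] at h1
        simp at h1
        omega
      · simp only [checkReveal, Bool.and_eq_true, beq_iff_eq] at hcheck
        obtain ⟨hentry, hcheck⟩ := hcheck
        rw [hoff] at hcheck
        have hentry' : o.entry ≠ D.getD (m * 2 ^ q + pathIndex path) ([], []) := by
          rintro he
          rw [← he] at hleaf
          exact hleaf hentry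
        have hj0 : m * 2 ^ q + pathIndex path ≠ 0 := by
          intro h0
          rw [if_pos h0] at hcheck
          rw [h0, hgenesis] at hentry'
          exact hentry' (by simpa using hcheck)
        rw [if_neg hj0, Bool.and_eq_true, hps, verifyEntry_append] at hcheck
        obtain ⟨hver, htrans⟩ := hcheck
        have hfinish : o.prev = D.getD (m * 2 ^ q + pathIndex path - 1) ([], []) →
            Evidence V D openNode ps₁.length o := fun he =>
          .transition (m * 2 ^ q + pathIndex path - 1) (by rw [add_mul] at hm; omega) he
            (by rwa [Nat.sub_add_cancel (by omega)]) htrans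
        have hoff' : totalLeaves ps₁ = m * 2 ^ q := hoff
        split_ifs at hver with hcase
        · rcases eq_or_honestCollision_of_verifyEntry hmatch hver with he | ⟨d, hd⟩
          · exact hfinish (by simpa using he)
          · exact .honest d hd
        · rw [hoff', show m * 2 ^ q + pathIndex path - 1 - m * 2 ^ q = pathIndex path - 1 by omega,
            verifyEntry, if_pos (by omega)] at hver
          simp only [verifyTree, Bool.and_eq_true, beq_iff_eq] at hver
          rcases hprev o.prev o.prevProof hver.1 (by omega) hver.2 with
            he | ⟨d, hd⟩ | ⟨d, p', hd, hp', hdp⟩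
          · exact hfinish he
          · exact .honest d hd
          · exact .opened d p' ((Nat.pow_le_pow_right two_pos hd).trans hq)
              ((Nat.pow_le_pow_right two_pos hp').trans hq) (by simpa using hdp)
    · simp at h

/-! ### Efficient computation of Merkle trees, states and ledgers -/

/-- Searches the list `ys` for a string that collides with `x`. -/
def findCollision (H : Bits → Bits) (x : Bits) (ys : List Bits) : Bits :=
  ys.foldl (fun z y => if H y == H x && !(y == x) then y else z) x

theorem findCollision_spec {H : Bits → Bits} {x : Bits} {ys : List Bits}
    (h : ∃ y ∈ ys, x ≠ y ∧ H x = H y) :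
    x ≠ findCollision H x ys ∧ H x = H (findCollision H x ys) := by
  have key : ∀ (ys : List Bits) (z : Bits), (x ≠ z ∧ H x = H z) ∨ (∃ y ∈ ys, x ≠ y ∧ H x = H y) →
      x ≠ ys.foldl (fun z y => if H y == H x && !(y == x) then y else z) z ∧
        H x = H (ys.foldl (fun z y => if H y == H x && !(y == x) then y else z) z) := by
    intro ys
    induction ys with
    | nil => intro z h; simpa using h
    | cons y ys ih =>
      intro z h
      rw [List.foldl_cons]
      apply ih
      by_cases hy : x ≠ y ∧ H x = H y
      · left
        rw [if_pos (by simp [hy.2, hy.1.symm])]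
        exact hy
      · rw [if_neg (by simp only [Bool.and_eq_true, beq_iff_eq, Bool.not_eq_true', beq_eq_false_iff_ne]
                       exact fun hh => hy ⟨Ne.symm hh.2, hh.1.symm⟩)]
        rcases h with h | ⟨y', hy', h⟩
        · exact .inl h
        · rcases List.mem_cons.1 hy' with rfl | hy'
          · exact absurd h hy
          · exact .inr ⟨y', hy', h⟩
  exact key ys x (.inr h)

theorem exists_mem_of_mem_pairs {l : List Bits} {y : Bits} (h : y ∈ pairs l) :
    ∃ a ∈ l, ∃ b ∈ l, y = concat a b := by
  induction l using pairs.induct with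
  | case1 a b l ih =>
    rw [pairs, List.mem_cons] at h
    rcases h with rfl | h
    · exact ⟨a, by simp, b, by simp, rfl⟩
    · obtain ⟨a', ha, b', hb, h⟩ := ih h
      exact ⟨a', by simp [ha], b', by simp [hb], h⟩
  | case2 l h' => rw [pairs] at h <;> simp_all

/-- One step in the computation of `pairs`; the state consists of the reversed output and the
remaining input. -/
def pairsStep (s : List Bits × List Bits) : List Bits × List Bits :=
  if s.2.tail.isEmpty then s
  else (concat (s.2.headD []) (s.2.tail.headD []) :: s.1, s.2.tail.tail)

theorem foldl_pairsStep {l : List Bits} {m : List Bits} {out : List Bits}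
    (h : l.length ≤ m.length) :
    (m.foldl (fun s _ => pairsStep s) (out, l)).1 = (pairs l).reverse ++ out := by
  induction m generalizing l out with
  | nil =>
    obtain rfl : l = [] := by simpa using h
    simp [pairs]
  | cons x m ih =>
    match l with
    | [] =>
      rw [List.foldl_cons]
      exact ih (l := []) (by simp)
    | [y] =>
      have hfix : ∀ m : List Bits,
          m.foldl (fun s _ => pairsStep s) (out, [y]) = (out, [y]) := by
        intro m
        induction m with
        | nil => rfl
        | cons z m ih => simpa [pairsStep] using ih
      rw [hfix]
      simp [pairs]
    | y :: z :: l =>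
      rw [List.foldl_cons]
      change (m.foldl (fun s _ => pairsStep s) (concat y z :: out, l)).1 = _
      rw [ih (by simp at h; omega)]
      simp [pairs]

/-- Concatenation makes strings at most five times as long, so that a weighted size of the state
does not grow. -/
theorem sz_pairsStep_le (s : List Bits × List Bits) :
    sz (pairsStep s).1 + 5 * sz (pairsStep s).2 ≤ sz s.1 + 5 * sz s.2 := by
  obtain ⟨out, l⟩ := s
  match l with
  | [] => exact le_rfl
  | [y] => exact le_rfl
  | y :: z :: l =>
    change sz (concat y z :: out) + 5 * sz l ≤ _
    have := sz_concat_le y z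
    have := one_le_sz z
    simp only [sz_list_cons]
    omega

theorem foldl_concat_levelStrings (H : Bits → Bits) (D : List Entry) (n : ℕ) :
    (List.replicate n ()).foldl (fun s _ => pairs (s.map H)) (D.map leafString) =
      levelStrings H D n := by
  induction n with
  | zero => rfl
  | succ n ih => rw [List.replicate_succ', List.foldl_append, ih]; rfl

theorem length_levelStrings_le (H : Bits → Bits) (D : List Entry) (n : ℕ) :
    (levelStrings H D n).length ≤ D.length := by
  induction n with
  | zero => simp [levelStrings]
  | succ n ih => exact (length_pairs_le _).trans (by simpa using ih)

section

variable {α : Type} [Enc α]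

namespace PolyTime

theorem pairs {l : α → List Bits} (hl : PolyTime l) : PolyTime fun a => pairs (l a) := by
  have hstep : PolyTime fun s : List Bits × List Bits => pairsStep s :=
    id.snd.tail.isEmpty.cond id ((((id.snd.headD enc_bits_nil).concat
      (id.snd.tail.headD enc_bits_nil)).cons id.fst).pair id.snd.tail.tail)
  have h := (foldl (step := fun (_ : α) (s : List Bits × List Bits) (_ : Bits) => pairsStep s)
    (B := fun a => 5 * sz (l a) + 2) hl ((const []).pair hl) (hstep.comp id.snd.fst)
    (((PolyBdd.const 5).mul hl.polyBdd).add (.const 2)) ?_).fst.reverse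
  · convert h using 2 with a
    rw [foldl_pairsStep le_rfl, List.append_nil, List.reverse_reverse]
  · intro a l' _
    have key : ∀ (l' : List Bits) (s : List Bits × List Bits),
        sz (l'.foldl (fun s _ => pairsStep s) s).1 +
          5 * sz (l'.foldl (fun s _ => pairsStep s) s).2 ≤ sz s.1 + 5 * sz s.2 := by
      intro l'
      induction l' with
      | nil => intro s; exact le_rfl
      | cons x l' ih => intro s; exact (ih _).trans (sz_pairsStep_le s)
    have h1 := key l' ([], l a)
    have h2 : ∀ s : List Bits × List Bits, sz s = sz s.1 + sz s.2 + 1 := fun _ => rfl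
    have h3 := one_le_sz (l'.foldl (fun s _ => pairsStep s) (([] : List Bits), l a)).2
    rw [h2]
    simp only [sz_list_nil] at h1
    omega

section

variable {H : α → Bits → Bits} {N : α → ℕ}

theorem climbStr (hH : PolyTime fun x : α × Bits => H x.1 x.2) (hN : PolyBdd N)
    (hHN : ∀ a x, sz (H a x) ≤ N a) {d : α → List Bool} {π : α → List Bits} {x : α → Bits}
    (hd : PolyTime d) (hπ : PolyTime π) (hx : PolyTime x) :
    PolyTime fun a => climbStr (H a) (d a) (π a) (x a) := by
  have hh : PolyTime fun x : α × (Bits × List Bool) × Bits => H x.1 x.2.1.1 :=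
    hH.comp (id.fst.pair id.snd.fst.fst)
  have hstep : PolyTime fun x : α × (Bits × List Bool) × Bits => climbStep (H x.1) x.2.1 x.2.2 :=
    id.snd.fst.snd.isEmpty.cond id.snd.fst
      (((id.snd.fst.snd.headD enc_false).cond (id.snd.snd.concat hh)
        (hh.concat id.snd.snd)).pair id.snd.fst.snd.tail)
  refine (foldl_of_growth (step := fun a => climbStep (H a)) hπ (hx.pair hd) hstep
    (G := fun y => 5 * N y.1 + 5 * sz y.2 + 1) ?_ fun a s y => ?_).fst
  · exact (((PolyBdd.const 5).mul (hN.comp (PolyTime.fst id).polyBdd)).add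
      ((PolyBdd.const 5).mul (PolyTime.snd id).polyBdd)).add (.const 1)
  · obtain ⟨x, d⟩ := s
    cases d with
    | nil => simp [climbStep]
    | cons b d =>
      have h1 := sz_concat_le y (H a x)
      have h2 := sz_concat_le (H a x) y
      have h3 := hHN a x
      have h4 := one_le_sz x
      cases b <;>
      · simp only [climbStep, List.isEmpty_cons, Bool.false_eq_true, if_false, if_true,
          List.headD_cons, List.tail_cons, sz_pair, sz_list_cons]
        omega

/-- All levels consist of at most `D.length` strings, which above the leaves are concatenations of
two hash values, so that the intermediate values have polynomial size. -/
theorem levelStrings (hH : PolyTime fun x : α × Bits => H x.1 x.2) (hN : PolyBdd N)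
    (hHN : ∀ a x, sz (H a x) ≤ N a) {D : α → List Entry} {t : α → ℕ}
    (hD : PolyTime D) (ht : PolyTime t) :
    PolyTime fun a => levelStrings (H a) (D a) (t a) := by
  have hinit : PolyTime fun a => (D a).map LightClient.leafString :=
    hD.map (f := fun _ => LightClient.leafString) (leafString id.snd)
  have h := foldl (step := fun (a : α) (s : List Bits) (_ : Unit) => LightClient.pairs (s.map (H a)))
    (B := fun a => sz ((D a).map LightClient.leafString) + (sz (D a) * (6 * N a + 1 + 1) + 1))
    ht.replicate hinit (pairs (map id.snd.fst (hH.comp (id.fst.fst.pair id.snd))))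
    (hinit.polyBdd.add ((hD.polyBdd.mul ((((PolyBdd.const 6).mul hN).add (.const 1)).add
      (.const 1))).add (.const 1))) ?_
  · convert h using 2 with a
    rw [foldl_concat_levelStrings]
  · intro a l' _
    have h1 : l' = List.replicate l'.length () := List.eq_replicate_of_mem fun _ _ => rfl
    rw [h1, foldl_concat_levelStrings]
    cases l'.length with
    | zero => exact Nat.le_add_right _ _
    | succ n =>
      refine le_trans ?_ (Nat.le_add_left _ _)
      refine (sz_list_le (M := 6 * N a + 1) fun y hy => ?_).trans ?_
      · obtain ⟨u, hu, v, hv, rfl⟩ := exists_mem_of_mem_pairs hy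
        rw [List.mem_map] at hu hv
        obtain ⟨u, _, rfl⟩ := hu
        obtain ⟨v, _, rfl⟩ := hv
        have := sz_concat_le (H a u) (H a v)
        have := hHN a u
        have := hHN a v
        omega
      · gcongr
        exact (length_levelStrings_le _ _ _).trans (length_le_sz _)

theorem findCollision (hH : PolyTime fun x : α × Bits => H x.1 x.2) {x : α → Bits}
    {ys : α → List Bits} (hx : PolyTime x) (hys : PolyTime ys) :
    PolyTime fun a => findCollision (H a) (x a) (ys a) := by
  have hx' : PolyTime fun y : α × Bits × Bits => x y.1 := hx.comp id.fst
  refine foldl_of_growth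
    (step := fun (a : α) (z y : Bits) => if H a y == H a (x a) && !(y == x a) then y else z) hys hx
    ((((hH.comp (id.fst.pair id.snd.snd)).beq (hH.comp (id.fst.pair hx'))).and
      (id.snd.snd.beq hx').not).cond id.snd.snd id.snd.fst)
    (G := fun y => sz y.2) (PolyTime.snd id).polyBdd fun a z y => ?_
  change _ ≤ sz z + sz y
  split_ifs <;> omega

end

theorem hash (𝓗 : HashFamily) {k : α → ℕ} {s : α → Key} {x : α → Bits}
    (hk : PolyTime k) (hs : PolyTime s) (hx : PolyTime x) :
    PolyTime fun a => 𝓗.hash (k a) (s a) (x a) :=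
  𝓗.hash_polyTime.comp (hk.pair (hs.pair hx))

/-- The length of a hash value does not depend on the hashed string; hence it is bounded by a
polynomial in the sizes of the security parameter and the key. -/
theorem exists_polyBdd_hash (𝓗 : HashFamily) {k : α → ℕ} {s : α → Key} (hk : PolyTime k)
    (hs : PolyTime s) : ∃ N : α → ℕ, PolyBdd N ∧ ∀ a x, sz (𝓗.hash (k a) (s a) x) ≤ N a := by
  refine ⟨fun a => 4 * sz (𝓗.hash (k a) (s a) []) + 1,
    ((PolyBdd.const 4).mul (hash 𝓗 hk hs (const [])).polyBdd).add (.const 1), fun a x => ?_⟩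
  have h1 := sz_bits_le (𝓗.hash (k a) (s a) x)
  have h2 := length_le_sz (𝓗.hash (k a) (s a) [])
  rw [𝓗.length_hash] at h1 h2
  change _ ≤ 4 * sz (𝓗.hash (k a) (s a) []) + 1
  omega

theorem run (X : ExecutionLayer) {k : α → ℕ} {s : α → Key} {L : α → List Tx}
    (hk : PolyTime k) (hs : PolyTime s) (hL : PolyTime L) :
    PolyTime fun a => X.run (k a) (s a) (L a) := by
  obtain ⟨p, hp⟩ := X.state_size
  have hksL := hk.pair (hs.pair hL)
  refine foldl (step := fun a => X.δ (k a) (s a)) (B := fun a => 4 * p.eval (sz (k a, s a, L a)) + 1)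
    hL (X.genesis_polyTime.comp (hk.pair hs))
    (X.δ_polyTime.comp ((hk.comp id.fst).pair ((hs.comp id.fst).pair id.snd)))
    (((PolyBdd.const 4).mul (hksL.polyBdd.eval p)).add (.const 1)) fun a l' hl' => ?_
  refine (sz_bits_le _).trans ?_
  gcongr
  refine (hp (k a) (s a) l').trans (eval_mono p ?_)
  have := sz_prefix_le hl'
  change sz (k a, s a, l') ≤ _
  simp only [sz_pair]
  omega

theorem augment (X : ExecutionLayer) {k : α → ℕ} {s : α → Key} {L : α → List Tx}
    (hk : PolyTime k) (hs : PolyTime s) (hL : PolyTime L) :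
    PolyTime fun a => X.augment (k a) (s a) (L a) := by
  have hk' : PolyTime fun x : α × ℕ => k x.1 := hk.comp id.fst
  have hs' : PolyTime fun x : α × ℕ => s x.1 := hs.comp id.fst
  have hL' : PolyTime fun x : α × ℕ => L x.1 := hL.comp id.fst
  exact ((const []).pair (X.commit_polyTime.comp (hk.pair (hs.pair
    (X.genesis_polyTime.comp (hk.pair hs)))))).cons (hL.length.range.map
      (f := fun a i => ((L a).getD i [], X.commit (k a) (s a) (X.run (k a) (s a)
        ((L a).take (i + 1)))))
      ((getD enc_bits_nil id.snd hL').pair (X.commit_polyTime.comp (hk'.pair (hs'.pair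
        (run X hk' hs' (id.snd.succ.take hL')))))))

end PolyTime

end

/-! ### Probabilities and guessing -/

section

variable {Ω Ω' R : Type} [Fintype Ω] [Fintype Ω'] [Fintype R]

theorem prob_nonneg (E : Ω → Prop) : 0 ≤ prob E := by unfold prob; positivity

theorem prob_mono {E F : Ω → Prop} (h : ∀ ω, E ω → F ω) : prob E ≤ prob F := by
  unfold prob
  gcongr
  exact Nat.card_le_card_of_injective (fun x => (⟨x.1, h _ x.2⟩ : {x // F x}))
    fun x y hxy => Subtype.ext (by simpa using hxy)

theorem prob_or_le (E F : Ω → Prop) : prob (fun ω => E ω ∨ F ω) ≤ prob E + prob F := by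
  unfold prob
  rw [← add_div]
  gcongr
  classical
  rw [Nat.card_eq_fintype_card, Nat.card_eq_fintype_card, Nat.card_eq_fintype_card]
  exact_mod_cast Fintype.card_subtype_or E F

theorem one_sub_prob [Nonempty Ω] (E : Ω → Prop) : 1 - prob E = prob fun ω => ¬ E ω := by
  classical
  unfold prob
  have h := Fintype.card_subtype_compl E
  have h' := Fintype.card_subtype_le E
  have h0 : (Fintype.card Ω : ℝ) ≠ 0 := by simp
  rw [Nat.card_eq_fintype_card, Nat.card_eq_fintype_card, h, Nat.cast_sub h']
  field_simp

theorem prob_equiv (e : Ω ≃ Ω') (E : Ω' → Prop) : prob (fun ω => E (e ω)) = prob E := by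
  unfold prob
  rw [Fintype.card_congr e, Nat.card_congr (e.subtypeEquiv (q := E) fun _ => Iff.rfl)]

theorem prob_fst [Nonempty R] (E : Ω → Prop) : prob (fun ω : Ω × R => E ω.1) = prob E := by
  unfold prob
  have e : {ω : Ω × R // E ω.1} ≃ {ω // E ω} × R :=
    { toFun := fun x => (⟨x.1.1, x.2⟩, x.1.2)
      invFun := fun x => ⟨(x.1.1, x.2), x.1.2⟩
      left_inv := fun _ => rfl
      right_inv := fun _ => rfl }
  rw [Nat.card_congr e, Nat.card_prod, Fintype.card_prod, Nat.card_eq_fintype_card (α := R)]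
  have h0 : (Fintype.card R : ℝ) ≠ 0 := by simp
  push_cast
  rw [mul_div_mul_right _ _ h0]

theorem prob_comp_fst [Nonempty R] (e : Ω ≃ Ω' × R) (E : Ω' → Prop) :
    prob (fun ω => E (e ω).1) = prob E :=
  (prob_equiv e fun x => E x.1).trans (prob_fst E)

/-- If for every outcome in an event there is a short string such that `E` holds for all coins
that begin with this string, then this event is not much more probable than `E`, because random
coins begin with a given string of length at most `m` with probability at least `2⁻ᵐ`. -/
theorem prob_exists_prefix_le {N m : ℕ} (hm : m ≤ N) (E : Ω × Coins N → Prop) :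
    prob (fun ω => ∃ γ : Bits, γ.length ≤ m ∧ ∀ g : Coins N, γ <+: List.ofFn g → E (ω, g)) ≤
      2 ^ m * prob E := by
  classical
  set Q : Ω → Prop := fun ω =>
    ∃ γ : Bits, γ.length ≤ m ∧ ∀ g : Coins N, γ <+: List.ofFn g → E (ω, g) with hQ
  have hspec : ∀ x : {ω // Q ω}, ∃ γ : Bits, γ.length ≤ m ∧
      ∀ g : Coins N, γ <+: List.ofFn g → E (x.1, g) := fun x => x.2
  choose γ hγm hγ using hspec
  let override : {ω // Q ω} → Coins N → Coins N := fun x g i =>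
    if h : i.1 < (γ x).length then (γ x)[i.1] else g i
  have hover : ∀ x g, γ x <+: List.ofFn (override x g) := by
    intro x g
    rw [List.prefix_iff_getElem]
    refine ⟨by simpa using (hγm x).trans hm, fun i hi => ?_⟩
    simp [override, hi]
  let f : {ω // Q ω} × Coins N → Coins m × {y : Ω × Coins N // E y} := fun x =>
    (fun i => x.2 (Fin.castLE hm i), ⟨(x.1.1, override x.1 x.2), hγ x.1 _ (hover x.1 x.2)⟩)
  have hf : Function.Injective f := by
    rintro ⟨x, g⟩ ⟨x', g'⟩ h
    simp only [f, Prod.mk.injEq, Subtype.mk.injEq] at h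
    obtain ⟨h1, h2, h3⟩ := h
    obtain rfl : x = x' := Subtype.ext h2
    refine Prod.ext rfl (funext fun i => ?_)
    change g i = g' i
    by_cases hi : i.1 < (γ x).length
    · exact congrFun h1 ⟨i.1, hi.trans_le (hγm x)⟩
    · have := congrFun h3 i
      simpa [override, hi] using this
  have hcard := Nat.card_le_card_of_injective f hf
  rw [Nat.card_prod, Nat.card_prod, Nat.card_eq_fintype_card (α := Coins N),
    Nat.card_eq_fintype_card (α := Coins m), Fintype.card_fun, Fintype.card_fun, Fintype.card_fin,
    Fintype.card_fin, Fintype.card_bool] at hcard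
  unfold prob
  rw [Fintype.card_prod, Fintype.card_fun, Fintype.card_fin, Fintype.card_bool]
  rcases Nat.eq_zero_or_pos (Fintype.card Ω) with h0 | h0
  · simp [h0]
  · have h0' : (0 : ℝ) < Fintype.card Ω := by exact_mod_cast h0
    push_cast
    rw [← mul_div_assoc, div_le_div_iff₀ h0' (by positivity)]
    have hcard' : (Nat.card {ω // Q ω} : ℝ) * 2 ^ N ≤ 2 ^ m * Nat.card {y // E y} := by
      exact_mod_cast hcard
    calc (Nat.card {ω // Q ω} : ℝ) * (Fintype.card Ω * 2 ^ N)
        = Nat.card {ω // Q ω} * 2 ^ N * Fintype.card Ω := by ring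
      _ ≤ 2 ^ m * Nat.card {y // E y} * Fintype.card Ω := by gcongr

end

/-- Coin strings of length `a + b` are pairs of coin strings. -/
def coinsSplit {n a b : ℕ} (h : n = a + b) : Coins n ≃ Coins a × Coins b :=
  ((finCongr h).arrowCongr (Equiv.refl Bool)).trans (Fin.appendEquiv a b).symm

theorem ofFn_coinsSplit {n a b : ℕ} (h : n = a + b) (x : Coins n) :
    List.ofFn x = List.ofFn (coinsSplit h x).1 ++ List.ofFn (coinsSplit h x).2 := by
  subst h
  rw [← List.ofFn_fin_append]
  congr 1
  exact ((Fin.appendEquiv a b).apply_symm_apply x).symm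

/-! ### Negligible functions -/

theorem Negligible.add {f g : ℕ → ℝ} (hf : Negligible f) (hg : Negligible g) :
    Negligible fun k => f k + g k :=
  Asymptotics.SuperpolynomialDecay.add hf hg

theorem Negligible.of_le_mul {f g : ℕ → ℝ} (hf : Negligible f) (p : Polynomial ℕ)
    (hg : ∀ k, 0 ≤ g k) (h : ∀ k, g k ≤ p.eval k * f k) : Negligible g := by
  have h1 := Asymptotics.SuperpolynomialDecay.polynomial_mul hf (p.map (Nat.castRingHom ℝ))
  refine h1.trans_abs_le fun k => ?_
  rw [abs_of_nonneg (hg k)]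
  refine (h k).trans (le_trans (le_of_eq ?_) (le_abs_self _))
  congr 1
  simp [Polynomial.eval_map, Polynomial.eval₂_at_natCast]

/-! ### Ledgers -/

theorem infix_of_getElem? {α : Type} {l : List α} {j : ℕ} {a b : α} (ha : l[j]? = some a)
    (hb : l[j + 1]? = some b) : [a, b] <:+: l := by
  obtain ⟨h1, rfl⟩ := List.getElem?_eq_some_iff.1 ha
  obtain ⟨h2, rfl⟩ := List.getElem?_eq_some_iff.1 hb
  refine ⟨l.take j, l.drop (j + 2), ?_⟩
  conv_rhs => rw [← List.take_append_drop j l, List.drop_eq_getElem_cons h1,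
    List.drop_eq_getElem_cons h2]
  simp

theorem getElem?_succ_of_infix {α : Type} {l : List α} {j : ℕ} {a b : α} (hl : l.Nodup)
    (h : [a, b] <:+: l) (ha : l[j]? = some a) : l[j + 1]? = some b := by
  obtain ⟨u, v, rfl⟩ := h
  obtain rfl : u.length = j := (List.getElem?_inj (by simp) hl).1 (by rw [ha]; simp)
  simp

theorem takeWhile_ne_eq_take {α : Type} [BEq α] [LawfulBEq α] {l : List α} {j : ℕ} {a : α}
    (hl : l.Nodup) (ha : l[j]? = some a) : l.takeWhile (fun x => !(x == a)) = l.take j := by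
  induction l generalizing j with
  | nil => simp
  | cons b l ih =>
    rw [List.nodup_cons] at hl
    cases j with
    | zero => simp at ha; simp [ha]
    | succ j =>
      rw [List.getElem?_cons_succ] at ha
      have hb : b ≠ a := by rintro rfl; exact hl.1 (List.mem_of_getElem? ha)
      simp [hb, ih hl.2 ha]

theorem ExecutionLayer.length_augment (X : ExecutionLayer) (k : ℕ) (s : Key) (L : List Tx) :
    (X.augment k s L).length = L.length + 1 := by
  simp [augment]

theorem ExecutionLayer.getD_augment (X : ExecutionLayer) (k : ℕ) (s : Key) {L : List Tx} {j : ℕ}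
    (h : j ≤ L.length) : (X.augment k s L).getD j ([], []) =
      (([] :: L).getD j [], X.commit k s (X.run k s (L.take j))) := by
  cases j with
  | zero => rfl
  | succ j =>
    have h' : j < L.length := h
    simp [augment, h']

theorem ExecutionLayer.run_take_succ (X : ExecutionLayer) (k : ℕ) (s : Key) {L : List Tx} {j : ℕ}
    (h : j < L.length) :
    X.run k s (L.take (j + 1)) = X.δ k s (X.run k s (L.take j)) (L.getD j []) := by
  rw [run, List.take_succ_eq_append_getElem h, List.foldl_append]
  simp [run, h]

namespace Consensus

variable {C : Consensus} {𝓗 : HashFamily}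

theorem exists_longest_eq {k : ℕ} (s : Key) (w : Bits) (r : ℕ) (hk : 0 < C.honest k) :
    ∃ P < C.honest k, C.longest k s w r = C.ledger k s w P r ∧
      ∀ P' < C.honest k, (C.ledger k s w P' r).length ≤ (C.longest k s w r).length := by
  set l := (List.range (C.honest k)).map fun P => C.ledger k s w P r with hl
  have hne : l.argmax List.length ≠ none := by
    rw [Ne, List.argmax_eq_none, hl, List.map_eq_nil_iff, List.range_eq_nil]
    omega
  obtain ⟨M, hM⟩ := Option.ne_none_iff_exists'.1 hne
  have hlong : C.longest k s w r = M := by rw [longest, ← hl, hM]; rfl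
  have hmem := List.argmax_mem hM
  rw [hl, List.mem_map] at hmem
  obtain ⟨P, hP, hPM⟩ := hmem
  refine ⟨P, List.mem_range.1 hP, by rw [hlong, hPM], fun P' hP' => ?_⟩
  rw [hlong]
  exact List.le_of_mem_argmax (List.mem_map.2 ⟨P', List.mem_range.2 hP', rfl⟩) hM

/-- Two ledgers of the same round are both prefixes of a ledger of the next round, so that the
shorter one is a prefix of the longer one. -/
theorem ledger_prefix_longest (hsafe : C.Safe 𝓗) {k : ℕ} (g : 𝓗.KeyCoins k) (w : C.ExecCoins k)
    {P r r' : ℕ} (hP : P < C.honest k) (hr : r ≤ r') :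
    C.ledger k (𝓗.key k g) (List.ofFn w) P r <+: C.longest k (𝓗.key k g) (List.ofFn w) r' := by
  obtain ⟨P', hP', heq, hlen⟩ := C.exists_longest_eq (𝓗.key k g) (List.ofFn w) r' (Nat.zero_lt_of_lt hP)
  rcases hr.lt_or_eq with hr | rfl
  · rw [heq]
    exact hsafe k g w P P' r r' hP hP' hr
  · have h := hlen P hP
    rw [heq] at h ⊢
    exact List.prefix_of_prefix_length_le (hsafe k g w P P r (r + 1) hP hP r.lt_succ_self)
      (hsafe k g w P' P r (r + 1) hP' hP r.lt_succ_self) h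

theorem follows_of_lt_length (hsafe : C.Safe 𝓗) {k : ℕ} (g : 𝓗.KeyCoins k) (w : C.ExecCoins k)
    {P r j : ℕ} (hP : P < C.honest k)
    (hj : j < (C.ledger k (𝓗.key k g) (List.ofFn w) P r).length) :
    C.Follows k (𝓗.key k g) (List.ofFn w) r
      (([] :: C.ledger k (𝓗.key k g) (List.ofFn w) P r).getD j [])
      ((C.ledger k (𝓗.key k g) (List.ofFn w) P r).getD j []) := by
  obtain ⟨v, hv⟩ := ledger_prefix_longest hsafe g w hP (le_refl r)
  set L := C.ledger k (𝓗.key k g) (List.ofFn w) P r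
  rw [Follows, ← hv, ← List.cons_append]
  refine List.IsInfix.trans ?_ (List.prefix_append _ v).isInfix
  refine infix_of_getElem? (j := j) ?_ ?_
  · have : j < ([] :: L).length := by simp; omega
    rw [List.getD_eq_getElem _ _ this, List.getElem?_eq_getElem this]
  · simp [hj]

theorem getElem?_of_follows (hsafe : C.Safe 𝓗) (hdistinct : C.DistinctTransactions 𝓗) {k : ℕ}
    (g : 𝓗.KeyCoins k) (w : C.ExecCoins k) {P r r' j : ℕ} {tx : Tx} (hP : P < C.honest k)
    (hr : r ≤ r') (hj : j < (C.ledger k (𝓗.key k g) (List.ofFn w) P r).length)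
    (h : C.Follows k (𝓗.key k g) (List.ofFn w) r'
      (([] :: C.ledger k (𝓗.key k g) (List.ofFn w) P r).getD j []) tx) :
    (C.ledger k (𝓗.key k g) (List.ofFn w) P r)[j]? = some tx := by
  obtain ⟨v, hv⟩ := ledger_prefix_longest hsafe g w hP hr
  obtain ⟨P', hP', heq, -⟩ := C.exists_longest_eq (𝓗.key k g) (List.ofFn w) r' (Nat.zero_lt_of_lt hP)
  have hnodup := hdistinct k g w P' r' hP'
  rw [← heq] at hnodup
  rw [Follows] at h
  set L := C.ledger k (𝓗.key k g) (List.ofFn w) P r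
  have hlt : j < ([] :: L).length := by simp; omega
  have h1 := getElem?_succ_of_infix hnodup h (j := j) (by
    rw [← hv, ← List.cons_append, List.getElem?_append_left hlt, List.getD_eq_getElem _ _ hlt,
      List.getElem?_eq_getElem hlt])
  rw [← hv, List.getElem?_cons_succ, List.getElem?_append_left hj] at h1
  exact h1

end Consensus

/-! ### Attacks derived from a responder -/

/-- The guess encoded at the beginning of a string of coins: the number `i` of a peak, the path
`p` to a leaf, the path `p'` to an inner node, directions `d` for climbing along a Merkle proof,
and a bit `b` that selects this proof. -/
def guess (g : Bits) : ℕ × List Bool × List Bool × List Bool × Bool :=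
  let x₁ := unconcat g
  let x₂ := unconcat x₁.2
  let x₃ := unconcat x₂.2
  let x₄ := unconcat x₃.2
  (x₁.1.length, x₂.1, x₃.1, x₄.1, x₄.2.headD false)

/-- A string on which `guess` has a given value. -/
def encodeGuess (i : ℕ) (p p' d : List Bool) (b : Bool) : Bits :=
  concat (List.replicate i false) (concat p.reverse (concat p'.reverse (concat d.reverse [b])))

theorem guess_encodeGuess_append (i : ℕ) (p p' d : List Bool) (b : Bool) (g : Bits) :
    guess (encodeGuess i p p' d b ++ g) = (i, p, p', d, b) := by
  rw [encodeGuess, ← concat_append, ← concat_append, ← concat_append, ← concat_append]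
  simp [guess, unconcat_concat]

theorem length_encodeGuess (i : ℕ) (p p' d : List Bool) (b : Bool) :
    (encodeGuess i p p' d b).length = 2 * (i + p.length + p'.length + d.length) + 5 := by
  simp only [encodeGuess, length_concat, List.length_replicate, List.length_reverse,
    List.length_singleton]
  ring

/-- What the responder knows when it makes its claim: the security parameter, the key, its coins
and the view of the execution. -/
abbrev Info := ℕ × Key × Bits × Bits

/-- The security parameter, the key, the coins of the execution, those of the responder, and those
from which the guess is read. -/
abbrev Env := ℕ × Key × Bits × Bits × Bits

namespace Responder

variable (A : Responder)

/-- The final message of the responder in a bisection game that follows the guessed path, or a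
default value if it does not answer. -/
def reveal (info : Info) (g : Bits) : Reveal :=
  (A.openLeaf (info, (guess g).1, (guess g).2.1)).getD ⟨([], []), ([], []), [], []⟩

/-- The entry and the Merkle proof in which a collision is looked for: those of the initial claim,
or those of the entry before the leaf at which the bisection game ends. -/
def suspect (info : Info) (g : Bits) : Entry × List Bits :=
  if (guess g).2.2.2.2 = true then ((A.reveal info g).prev, (A.reveal info g).prevProof)
  else (((A.claim info).getD ⟨0, [], ([], []), []⟩).last,
    ((A.claim info).getD ⟨0, [], ([], []), []⟩).proof)

/-- The string hashed at the inner node that the responder opens at the guessed place; a default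
value if it does not answer. -/
def opening (info : Info) (g : Bits) : Bits :=
  concat ((A.openNode (info, (guess g).1, (guess g).2.2.1)).getD ([], [])).1
    ((A.openNode (info, (guess g).1, (guess g).2.2.1)).getD ([], [])).2

variable (𝓗 : HashFamily) (X : ExecutionLayer) (C : Consensus)

/-- The round at which the game is played. -/
def envRound (y : Env) : ℕ := A.round (y.1, y.2.1, y.2.2.2.1)

/-- What the responder knows at this round. -/
def envInfo (y : Env) : Info :=
  (y.1, y.2.1, y.2.2.2.1, C.view y.1 y.2.1 y.2.2.1 (A.envRound y))

/-- The dirty ledger of the responder's opponent. -/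
def envLedger (y : Env) : List Tx :=
  C.ledger y.1 y.2.1 y.2.2.1 (A.opponent (A.envInfo C y)) (A.envRound y)

/-- The last string that is hashed when one climbs in the guessed directions. -/
def climbed (y : Env) : Bits :=
  climbStr (𝓗.hash y.1 y.2.1) (guess y.2.2.2.2).2.2.2.1 (A.suspect (A.envInfo C y) y.2.2.2.2).2
    (leafString (A.suspect (A.envInfo C y) y.2.2.2.2).1)

/-- A pair of strings that is meant to be a collision: a string hashed in the verification of a
Merkle proof of the responder, and a string hashed by the challenger at the same height, or by the
verifier in the opening of a node. -/
def collisionAttack (y : Env) : Bits × Bits :=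
  (A.climbed 𝓗 C y, findCollision (𝓗.hash y.1 y.2.1) (A.climbed 𝓗 C y)
    (A.opening (A.envInfo C y) y.2.2.2.2 ::
      levelStrings (𝓗.hash y.1 y.2.1) (X.augment y.1 y.2.1 (A.envLedger C y))
        (guess y.2.2.2.2).2.2.2.1.length))

/-- A state, a transaction and a proof that are meant to violate the soundness of the execution
oracle: the state is that of the honest ledger before the revealed transaction. -/
def executionAttack (y : Env) : State × Tx × Bits :=
  (X.run y.1 y.2.1 ((A.envLedger C y).takeWhile fun tx =>
      !(tx == (A.reveal (A.envInfo C y) y.2.2.2.2).entry.1)),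
    (A.reveal (A.envInfo C y) y.2.2.2.2).entry.1,
    (A.reveal (A.envInfo C y) y.2.2.2.2).transition)

/-- Transactions that are meant to violate the soundness of the consensus oracle. -/
def consensusAttack (info : Info) (g : Bits) : Tx × Tx :=
  ((A.reveal info g).prev.1, (A.reveal info g).entry.1)

/-- The collision attack succeeds. -/
def CollisionEvent (y : Env) : Prop :=
  (A.collisionAttack 𝓗 X C y).1 ≠ (A.collisionAttack 𝓗 X C y).2 ∧
    𝓗.hash y.1 y.2.1 (A.collisionAttack 𝓗 X C y).1 = 𝓗.hash y.1 y.2.1 (A.collisionAttack 𝓗 X C y).2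

/-- The attack on the execution oracle succeeds. -/
def ExecutionEvent (y : Env) : Prop :=
  ∃ c, X.succinct y.1 y.2.1 (X.commit y.1 y.2.1 (A.executionAttack X C y).1)
      (A.executionAttack X C y).2.1 (A.executionAttack X C y).2.2 = some c ∧
    c ≠ X.commit y.1 y.2.1 (X.δ y.1 y.2.1 (A.executionAttack X C y).1 (A.executionAttack X C y).2.1)

/-- The attack on the consensus oracle succeeds: it accepts transactions that do not follow each
other on the longest ledger `ν` rounds later. -/
def ConsensusEvent (ν : ℕ) (y : Env) : Prop :=
  C.oracle y.1 y.2.1 y.2.2.1 (A.envRound y) (A.consensusAttack (A.envInfo C y) y.2.2.2.2).1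
      (A.consensusAttack (A.envInfo C y) y.2.2.2.2).2 = true ∧
    ¬ C.Follows y.1 y.2.1 y.2.2.1 (A.envRound y + ν)
      (A.consensusAttack (A.envInfo C y) y.2.2.2.2).1 (A.consensusAttack (A.envInfo C y) y.2.2.2.2).2

section PolyTime

variable {A 𝓗 X C} {α : Type} [Enc α] {info : α → Info} {g : α → Bits}

theorem polyTime_guess : PolyTime guess := by
  have h₁ : PolyTime fun g : Bits => unconcat g := PolyTime.id.unconcat
  have h₂ := h₁.snd.unconcat
  have h₃ := h₂.snd.unconcat
  have h₄ := h₃.snd.unconcat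
  exact h₁.fst.length.pair (h₂.fst.pair (h₃.fst.pair (h₄.fst.pair (h₄.snd.headD enc_false))))

theorem polyTime_claim_tuple :
    PolyTime fun c : Claim => (c.size, c.peaks, c.last, c.proof) := .of_enc_eq fun _ => rfl

theorem polyTime_reveal_tuple :
    PolyTime fun o : Reveal => (o.entry, o.prev, o.prevProof, o.transition) :=
  .of_enc_eq fun _ => rfl

theorem polyTime_reveal (hi : PolyTime info) (hg : PolyTime g) :
    PolyTime fun a => A.reveal (info a) (g a) :=
  (A.openLeaf_polyTime.comp (hi.pair ((polyTime_guess.comp hg).fst.pair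
    (polyTime_guess.comp hg).snd.fst))).optionGetD (.const _)

theorem polyTime_suspect (hi : PolyTime info) (hg : PolyTime g) :
    PolyTime fun a => A.suspect (info a) (g a) := by
  have ho := polyTime_reveal_tuple.comp (polyTime_reveal (A := A) hi hg)
  have hc := polyTime_claim_tuple.comp
    ((A.claim_polyTime.comp hi).optionGetD (.const ⟨0, [], ([], []), []⟩))
  exact (polyTime_guess.comp hg).snd.snd.snd.snd.cond (ho.snd.fst.pair ho.snd.snd.fst)
    (hc.snd.snd.fst.pair hc.snd.snd.snd)

theorem polyTime_opening (hi : PolyTime info) (hg : PolyTime g) :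
    PolyTime fun a => A.opening (info a) (g a) := by
  have h := (A.openNode_polyTime.comp (hi.pair ((polyTime_guess.comp hg).fst.pair
    (polyTime_guess.comp hg).snd.snd.fst))).optionGetD (.const ([], []))
  exact h.fst.concat h.snd

theorem polyTime_envRound : PolyTime fun y : Env => A.envRound y :=
  A.round_polyTime.comp (PolyTime.id.fst.pair (PolyTime.id.snd.fst.pair PolyTime.id.snd.snd.snd.fst))

theorem polyTime_envInfo : PolyTime fun y : Env => A.envInfo C y :=
  PolyTime.id.fst.pair (PolyTime.id.snd.fst.pair (PolyTime.id.snd.snd.snd.fst.pair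
    (C.view_polyTime.comp (PolyTime.id.fst.pair (PolyTime.id.snd.fst.pair
      (PolyTime.id.snd.snd.fst.pair polyTime_envRound))))))

theorem polyTime_envLedger : PolyTime fun y : Env => A.envLedger C y :=
  C.read_polyTime.comp (PolyTime.id.fst.pair (PolyTime.id.snd.fst.pair
    (polyTime_envInfo.snd.snd.snd.pair (A.opponent_polyTime.comp polyTime_envInfo))))

theorem polyTime_collisionAttack : PolyTime fun y : Env => A.collisionAttack 𝓗 X C y := by
  have hk : PolyTime fun y : Env => y.1 := PolyTime.id.fst
  have hs : PolyTime fun y : Env => y.2.1 := PolyTime.id.snd.fst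
  have hg : PolyTime fun y : Env => y.2.2.2.2 := PolyTime.id.snd.snd.snd.snd
  have hH : PolyTime fun x : Env × Bits => 𝓗.hash x.1.1 x.1.2.1 x.2 :=
    PolyTime.hash 𝓗 (hk.comp PolyTime.id.fst) (hs.comp PolyTime.id.fst) PolyTime.id.snd
  obtain ⟨N, hN, hHN⟩ := PolyTime.exists_polyBdd_hash 𝓗 hk hs
  have hd : PolyTime fun y : Env => (guess y.2.2.2.2).2.2.2.1 :=
    (polyTime_guess.comp hg).snd.snd.snd.fst
  have hsus := polyTime_suspect (A := A) (polyTime_envInfo (A := A) (C := C)) hg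
  have hx : PolyTime fun y : Env => A.climbed 𝓗 C y :=
    PolyTime.climbStr hH hN hHN hd hsus.snd (PolyTime.leafString hsus.fst)
  exact hx.pair (PolyTime.findCollision hH hx ((polyTime_opening polyTime_envInfo hg).cons
    (PolyTime.levelStrings hH hN hHN (PolyTime.augment X hk hs polyTime_envLedger) hd.length)))

theorem polyTime_executionAttack : PolyTime fun y : Env => A.executionAttack X C y := by
  have hk : PolyTime fun y : Env => y.1 := PolyTime.id.fst
  have hs : PolyTime fun y : Env => y.2.1 := PolyTime.id.snd.fst
  have ho := polyTime_reveal_tuple.comp (polyTime_reveal (A := A)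
    (polyTime_envInfo (A := A) (C := C)) PolyTime.id.snd.snd.snd.snd)
  refine PolyTime.pair (PolyTime.run X hk hs (PolyTime.takeWhile polyTime_envLedger
    (p := fun y tx => !(tx == (A.reveal (A.envInfo C y) y.2.2.2.2).entry.1)) ?_))
    (ho.fst.fst.pair ho.snd.snd.snd)
  exact (PolyTime.id.snd.beq (ho.fst.fst.comp PolyTime.id.fst)).not

theorem polyTime_consensusAttack (hi : PolyTime info) (hg : PolyTime g) :
    PolyTime fun a => A.consensusAttack (info a) (g a) := by
  have ho := polyTime_reveal_tuple.comp (polyTime_reveal (A := A) hi hg)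
  exact ho.snd.fst.fst.pair ho.fst.fst

end PolyTime

/-! ### A lost game yields a successful guess -/

variable {A 𝓗 X C}

theorem collisionEvent_of_mem {y : Env} {z : Bits} (hne : A.climbed 𝓗 C y ≠ z)
    (hz : 𝓗.hash y.1 y.2.1 (A.climbed 𝓗 C y) = 𝓗.hash y.1 y.2.1 z)
    (hmem : z ∈ A.opening (A.envInfo C y) y.2.2.2.2 ::
      levelStrings (𝓗.hash y.1 y.2.1) (X.augment y.1 y.2.1 (A.envLedger C y))
        (guess y.2.2.2.2).2.2.2.1.length) : A.CollisionEvent 𝓗 X C y :=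
  findCollision_spec ⟨z, hmem, hne, hz⟩

theorem collisionEvent_of_honestCollision {y : Env}
    (h : HonestCollision (𝓗.hash y.1 y.2.1) (X.augment y.1 y.2.1 (A.envLedger C y))
      (guess y.2.2.2.2).2.2.2.1 (A.suspect (A.envInfo C y) y.2.2.2.2).2
      (leafString (A.suspect (A.envInfo C y) y.2.2.2.2).1)) : A.CollisionEvent 𝓗 X C y := by
  obtain ⟨-, n, hn, hne, heq⟩ := h
  exact collisionEvent_of_mem hne heq
    (List.mem_cons_of_mem _ (honestString_mem_levelStrings _ hn))

/-- A wrong transition that passes the verifier's check violates the soundness of the consensus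
oracle, if its transaction is not the next one on the honest ledger, and otherwise that of the
execution oracle. -/
theorem consensusEvent_or_executionEvent (hsafe : C.Safe 𝓗) (hdistinct : C.DistinctTransactions 𝓗)
    (ν : ℕ) {k : ℕ} (κ : 𝓗.KeyCoins k) (w : C.ExecCoins k) (ρ g : Bits) {j : ℕ} {o : Reveal}
    {V : Verifier} :
    let y : Env := (k, 𝓗.key k κ, List.ofFn w, ρ, g)
    V.oracle = C.oracle k (𝓗.key k κ) (List.ofFn w) (A.envRound y) →
    V.succinct = X.succinct k (𝓗.key k κ) →
    A.opponent (A.envInfo C y) < C.honest k →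
    j < (A.envLedger C y).length →
    o.prev = (X.augment k (𝓗.key k κ) (A.envLedger C y)).getD j ([], []) →
    o.entry ≠ (X.augment k (𝓗.key k κ) (A.envLedger C y)).getD (j + 1) ([], []) →
    V.checkTransition o.prev o.entry o.transition = true →
    A.reveal (A.envInfo C y) g = o →
    A.ConsensusEvent C ν y ∨ A.ExecutionEvent X C y := by
  intro y hV hV' hP hj hprev hentry hcheck ho
  simp only [Verifier.checkTransition, Bool.and_eq_true, beq_iff_eq, hV, hV'] at hcheck
  obtain ⟨hor, hsucc⟩ := hcheck
  rw [X.getD_augment k _ hj.le] at hprev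
  rw [X.getD_augment k _ (Nat.succ_le_of_lt hj), X.run_take_succ k _ hj] at hentry
  by_cases hf : C.Follows k (𝓗.key k κ) (List.ofFn w) (A.envRound y + ν) o.prev.1 o.entry.1
  · right
    rw [hprev] at hf
    have hnext : (A.envLedger C y)[j]? = some o.entry.1 :=
      Consensus.getElem?_of_follows hsafe hdistinct κ w hP (Nat.le_add_right _ ν) hj hf
    have hnodup : (A.envLedger C y).Nodup :=
      (List.nodup_cons.1 (hdistinct k κ w _ (A.envRound y) hP)).2
    have htake : X.run k (𝓗.key k κ) ((A.envLedger C y).takeWhile fun tx => !(tx == o.entry.1)) =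
        X.run k (𝓗.key k κ) ((A.envLedger C y).take j) := by
      rw [takeWhile_ne_eq_take hnodup hnext]
    have htx : o.entry.1 = (A.envLedger C y).getD j [] := by
      rw [List.getD_eq_getElem?_getD, hnext]
      rfl
    rw [hprev] at hsucc
    refine ⟨o.entry.2, ?_, fun h => hentry ?_⟩
    · simp only [executionAttack, y] at ho htake ⊢
      rw [ho, htake]
      exact hsucc
    · simp only [executionAttack, y] at ho htake h
      rw [ho, htake] at h
      rw [List.getD_cons_succ]
      exact Prod.ext htx (by rw [h, ← htx])
  · left
    simp only [ConsensusEvent, consensusAttack, y] at ho ⊢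
    rw [ho]
    exact ⟨hor, hf⟩

/-- If the challenger is not among the winners, then a string of logarithmic length makes one of
the three attacks succeed, whatever coins follow it. The string encodes four numbers or paths of
at most logarithmic size with two bits for each unit, and five more bits. -/
theorem exists_guess (hsafe : C.Safe 𝓗) (hdistinct : C.DistinctTransactions 𝓗)
    (hCcomplete : C.Complete 𝓗) (hXcomplete : X.Complete 𝓗) (ν : ℕ) {tape : ℕ → ℕ} {bound k : ℕ}
    {ω : Sample 𝓗 C A tape bound k} (h : ¬ ChallengerWins (experiment 𝓗 X C A tape bound k ω))
    {M : ℕ} (hM : (A.envLedger C (k, 𝓗.key k ω.1, List.ofFn ω.2.1, List.ofFn ω.2.2.1, [])).length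
      < M) :
    ∃ γ : Bits, γ.length ≤ 8 * Nat.log 2 M + 5 ∧
      ((∀ g, A.CollisionEvent 𝓗 X C
          (k, 𝓗.key k ω.1, List.ofFn ω.2.1, List.ofFn ω.2.2.1, γ ++ g)) ∨
       (∀ g, A.ConsensusEvent C ν
          (k, 𝓗.key k ω.1, List.ofFn ω.2.1, List.ofFn ω.2.2.1, γ ++ g)) ∨
       (∀ g, A.ExecutionEvent X C
          (k, 𝓗.key k ω.1, List.ofFn ω.2.1, List.ofFn ω.2.2.1, γ ++ g))) := by
  obtain ⟨κ, w, ρ, t⟩ := ω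
  simp only at h hM ⊢
  set s := 𝓗.key k κ with hs
  set y : Env := (k, s, List.ofFn w, List.ofFn ρ, []) with hy
  have hinfo : ∀ g, A.envInfo C (k, s, List.ofFn w, List.ofFn ρ, g) = A.envInfo C y := fun _ => rfl
  have hledger : ∀ g, A.envLedger C (k, s, List.ofFn w, List.ofFn ρ, g) = A.envLedger C y :=
    fun _ => rfl
  unfold ChallengerWins at h
  push Not at h
  obtain ⟨v, hv, hv1, hv2⟩ := h
  simp only [experiment] at hv
  split at hv
  · simp at hv
  rename_i c hc
  split_ifs at hv with hplay
  obtain ⟨hP, hvalid, hsize, -⟩ := hplay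
  rw [Option.some.injEq] at hv
  subst hv
  have hc' : A.claim (A.envInfo C y) = some c := hc
  have hPy : A.opponent (A.envInfo C y) < C.honest k := hP
  have hpos : 1 ≤ c.size := by
    simp only [Claim.valid, Bool.and_eq_true, bne_iff_ne] at hvalid
    omega
  have hev := Verifier.exists_evidence hvalid hsize ?_ ?_ (not_or.2 ⟨hv1, hv2⟩)
  rotate_left
  · rfl
  · intro j h1 h2
    obtain ⟨i, rfl⟩ : ∃ i, j = i + 1 := ⟨j - 1, by omega⟩
    rw [X.length_augment] at h2
    have hi : i < (A.envLedger C y).length := by exact Nat.lt_of_succ_lt_succ h2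
    rw [Nat.add_sub_cancel]
    change Verifier.checkTransition _ ((X.augment k s (A.envLedger C y)).getD i _)
      ((X.augment k s (A.envLedger C y)).getD (i + 1) _) (X.prove k s (X.run k s
        ((A.envLedger C y).take i)) ((A.envLedger C y).getD i []) _) = true
    rw [X.getD_augment k s hi.le, X.getD_augment k s (Nat.succ_le_of_lt hi), X.run_take_succ k s hi]
    simp only [Verifier.checkTransition, Bool.and_eq_true, beq_iff_eq]
    exact ⟨hCcomplete k κ w _ _ _ (Consensus.follows_of_lt_length hsafe κ w hPy hi),
      hXcomplete k κ _ _ _⟩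
  have hlen : ∀ n, 2 ^ n ≤ (X.augment k s (A.envLedger C y)).length → n ≤ Nat.log 2 M := by
    intro n hn
    rw [X.length_augment] at hn
    exact Nat.le_log_of_pow_le one_lt_two (hn.trans hM)
  rcases hev with ⟨d, hd⟩ | ⟨i, p, o, hi, hp, ho, hev⟩
  · refine ⟨encodeGuess 0 [] [] d false, ?_, .inl fun g => collisionEvent_of_honestCollision ?_⟩
    · have := hlen _ hd.length_le
      rw [length_encodeGuess]
      simp only [List.length_nil]
      omega
    · simp only [suspect, guess_encodeGuess_append, hinfo, hledger, hc']
      exact hd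
  · have hi' : i ≤ Nat.log 2 M := hi.trans (Nat.log_mono_right (by
      change (X.augment k s (A.envLedger C y)).length ≤ M
      rw [X.length_augment]
      exact hM))
    have hp' := hlen _ hp
    have ho' : A.openLeaf (A.envInfo C y, i, p) = some o := ho
    have hrev : ∀ p' d b g, A.reveal (A.envInfo C y) (encodeGuess i p p' d b ++ g) = o := by
      intro p' d b g
      rw [reveal, guess_encodeGuess_append, ho']
      rfl
    cases hev with
    | honest d hd =>
      refine ⟨encodeGuess i p [] d true, ?_, .inl fun g => collisionEvent_of_honestCollision ?_⟩
      · have := hlen _ hd.length_le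
        rw [length_encodeGuess]
        simp only [List.length_nil]
        omega
      · simp only [suspect, hinfo, hledger, hrev, guess_encodeGuess_append]
        exact hd
    | opened d p' hd hp₂ hcoll =>
      refine ⟨encodeGuess i p p' d true, ?_, .inl fun g => ?_⟩
      · have := hlen _ hd
        have := hlen _ hp₂
        rw [length_encodeGuess]
        omega
      · obtain ⟨hl, hr, hans, hne, heq⟩ := hcoll
        have hans' : A.openNode (A.envInfo C y, i, p') = some (hl, hr) := hans
        refine collisionEvent_of_mem (z := concat hl hr) ?_ ?_ ?_
        · simp only [climbed, suspect, hinfo, hrev, guess_encodeGuess_append]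
          exact hne
        · simp only [climbed, suspect, hinfo, hrev, guess_encodeGuess_append]
          exact heq
        · rw [List.mem_cons]
          left
          simp only [opening, hinfo, guess_encodeGuess_append, hans']
          rfl
    | transition j hj hprev hentry hcheck =>
      have hj' : j < (A.envLedger C y).length := by
        change j + 1 < (X.augment k s (A.envLedger C y)).length at hj
        rw [X.length_augment] at hj
        omega
      have key : ∀ g, A.ConsensusEvent C ν (k, s, List.ofFn w, List.ofFn ρ,
            encodeGuess i p [] [] true ++ g) ∨
          A.ExecutionEvent X C (k, s, List.ofFn w, List.ofFn ρ,
            encodeGuess i p [] [] true ++ g) := fun g =>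
        consensusEvent_or_executionEvent hsafe hdistinct ν κ w (List.ofFn ρ) _ rfl rfl hPy hj'
          hprev hentry hcheck (hrev _ _ _ _)
      refine ⟨encodeGuess i p [] [] true, ?_, .inr ?_⟩
      · rw [length_encodeGuess]
        simp only [List.length_nil]
        omega
      · -- The attacks depend on the coins only through the guess.
        rcases key [] with h | h
        · refine .inl fun g => ?_
          simp only [ConsensusEvent, consensusAttack, hinfo, hrev] at h ⊢
          exact h
        · refine .inr fun g => ?_
          simp only [ExecutionEvent, executionAttack, hinfo, hledger, hrev] at h ⊢
          exact h

end Responder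

/-! ### The reductions -/

namespace Responder

variable {A : Responder} {𝓗 : HashFamily} {X : ExecutionLayer} {C : Consensus}

/-- Coins for the key, the execution and the responder. -/
abbrev BaseCoins (A : Responder) (𝓗 : HashFamily) (C : Consensus) (k : ℕ) :=
  𝓗.KeyCoins k × C.ExecCoins k × Coins (A.coins.eval k)

/-- The environment determined by coins for the key, the execution, the responder and the guess.
-/
def toEnv {G : Polynomial ℕ} {k : ℕ} (x : A.BaseCoins 𝓗 C k × Coins (G.eval k)) : Env :=
  (k, 𝓗.key k x.1.1, List.ofFn x.1.2.1, List.ofFn x.1.2.2, List.ofFn x.2)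

/-- Reads an environment from a single string of coins. -/
def splitEnv (A : Responder) (C : Consensus) (x : ℕ × Key × Bits) : Env :=
  (x.1, x.2.1, x.2.2.take (C.coins.eval x.1),
    (x.2.2.drop (C.coins.eval x.1)).take (A.coins.eval x.1),
    (x.2.2.drop (C.coins.eval x.1)).drop (A.coins.eval x.1))

theorem polyTime_splitEnv : PolyTime (splitEnv A C) := by
  have hc := PolyTime.polynomialEval C.coins (PolyTime.id (α := ℕ × Key × Bits)).fst
  have ha := PolyTime.polynomialEval A.coins (PolyTime.id (α := ℕ × Key × Bits)).fst
  have hx := (PolyTime.id (α := ℕ × Key × Bits)).snd.snd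
  exact PolyTime.id.fst.pair (PolyTime.id.snd.fst.pair ((hc.take hx).pair
    ((ha.take (hc.drop hx)).pair (ha.drop (hc.drop hx)))))

theorem take_ofFn_eq {n a b : ℕ} (h : n = a + b) (x : Coins n) :
    (List.ofFn x).take a = List.ofFn (coinsSplit h x).1 := by
  rw [ofFn_coinsSplit h, List.take_left' (by simp)]

theorem drop_ofFn_eq {n a b : ℕ} (h : n = a + b) (x : Coins n) :
    (List.ofFn x).drop a = List.ofFn (coinsSplit h x).2 := by
  rw [ofFn_coinsSplit h, List.drop_left' (by simp)]

/-- Coins of the consensus adversary, regrouped. -/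
noncomputable def regroupCoins (A : Responder) (𝓗 : HashFamily) (C : Consensus) (G : Polynomial ℕ)
    (k : ℕ) :
    𝓗.KeyCoins k × C.ExecCoins k × Coins ((A.coins + G).eval k) ≃
      A.BaseCoins 𝓗 C k × Coins (G.eval k) where
  toFun x := ((x.1, x.2.1, (coinsSplit Polynomial.eval_add x.2.2).1),
    (coinsSplit Polynomial.eval_add x.2.2).2)
  invFun y := (y.1.1, y.1.2.1, (coinsSplit Polynomial.eval_add).symm (y.1.2.2, y.2))
  left_inv x := by simp
  right_inv y := by simp

/-- Coins of the collision adversary and of the execution adversary, regrouped. -/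
noncomputable def splitCoins (A : Responder) (𝓗 : HashFamily) (C : Consensus) (G : Polynomial ℕ)
    (k : ℕ) :
    𝓗.KeyCoins k × Coins ((C.coins + (A.coins + G)).eval k) ≃
      A.BaseCoins 𝓗 C k × Coins (G.eval k) :=
  ((Equiv.refl _).prodCongr (coinsSplit Polynomial.eval_add)).trans (A.regroupCoins 𝓗 C G k)

theorem splitEnv_ofFn {G : Polynomial ℕ} {k : ℕ}
    (x : 𝓗.KeyCoins k × Coins ((C.coins + (A.coins + G)).eval k)) :
    splitEnv A C (k, 𝓗.key k x.1, List.ofFn x.2) = toEnv (A.splitCoins 𝓗 C G k x) := by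
  simp only [splitEnv, toEnv, take_ofFn_eq (Polynomial.eval_add (p := C.coins) (q := A.coins + G)),
    drop_ofFn_eq (Polynomial.eval_add (p := C.coins) (q := A.coins + G)),
    take_ofFn_eq (Polynomial.eval_add (p := A.coins) (q := G)),
    drop_ofFn_eq (Polynomial.eval_add (p := A.coins) (q := G))]
  rfl

theorem negligible_collisionEvent (hH : 𝓗.CollisionResistant) (G : Polynomial ℕ) :
    Negligible fun k => prob fun x : A.BaseCoins 𝓗 C k × Coins (G.eval k) =>
      A.CollisionEvent 𝓗 X C (toEnv x) := by
  have h := hH (C.coins + (A.coins + G)) (fun x => A.collisionAttack 𝓗 X C (splitEnv A C x))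
    (polyTime_collisionAttack.comp polyTime_splitEnv)
  convert h using 2 with k
  rw [← prob_equiv (A.splitCoins 𝓗 C G k)]
  congr 1
  funext x
  rw [← splitEnv_ofFn]
  rfl

theorem negligible_executionEvent (hX : X.Sound 𝓗) (G : Polynomial ℕ) :
    Negligible fun k => prob fun x : A.BaseCoins 𝓗 C k × Coins (G.eval k) =>
      A.ExecutionEvent X C (toEnv x) := by
  have h := hX (C.coins + (A.coins + G)) (fun x => A.executionAttack X C (splitEnv A C x))
    (polyTime_executionAttack.comp polyTime_splitEnv)
  convert h using 2 with k
  rw [← prob_equiv (A.splitCoins 𝓗 C G k)]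
  congr 1
  funext x
  rw [← splitEnv_ofFn]
  rfl

theorem negligible_consensusEvent {ν : ℕ} (hC : C.Sound 𝓗 ν) (G : Polynomial ℕ) :
    Negligible fun k => prob fun x : A.BaseCoins 𝓗 C k × Coins (G.eval k) =>
      A.ConsensusEvent C ν (toEnv x) := by
  have hround : PolyTime fun x : ℕ × Key × Bits =>
      A.round (x.1, x.2.1, x.2.2.take (A.coins.eval x.1)) :=
    A.round_polyTime.comp (PolyTime.id.fst.pair (PolyTime.id.snd.fst.pair
      ((PolyTime.polynomialEval A.coins PolyTime.id.fst).take PolyTime.id.snd.snd)))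
  have hm := PolyTime.polynomialEval A.coins (PolyTime.id (α := ℕ × Key × Bits × Bits)).fst
  have hattack : PolyTime fun x : ℕ × Key × Bits × Bits =>
      A.consensusAttack (x.1, x.2.1, x.2.2.1.take (A.coins.eval x.1), x.2.2.2)
        (x.2.2.1.drop (A.coins.eval x.1)) :=
    polyTime_consensusAttack (PolyTime.id.fst.pair (PolyTime.id.snd.fst.pair
      ((hm.take PolyTime.id.snd.snd.fst).pair PolyTime.id.snd.snd.snd)))
      (hm.drop PolyTime.id.snd.snd.fst)
  have h := hC (A.coins + G) _ _ hround hattack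
  convert h using 2 with k
  rw [← prob_equiv (A.regroupCoins 𝓗 C G k)]
  congr 1
  funext x
  simp only [take_ofFn_eq (Polynomial.eval_add (p := A.coins) (q := G)),
    drop_ofFn_eq (Polynomial.eval_add (p := A.coins) (q := G))]
  rfl

/-- The ledgers that occur in the game have polynomial length. -/
theorem exists_length_envLedger_lt (A : Responder) (𝓗 : HashFamily) (C : Consensus) :
    ∃ P : Polynomial ℕ, ∀ (k : ℕ) (x : A.BaseCoins 𝓗 C k),
      (A.envLedger C (k, 𝓗.key k x.1, List.ofFn x.2.1, List.ofFn x.2.2, [])).length < P.eval k := by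
  have hpoly : PolyTime fun x : ℕ × Bits × Bits × Bits =>
      A.envLedger C (x.1, 𝓗.gen x.1 x.2.1, x.2.2.1, x.2.2.2, []) :=
    polyTime_envLedger.comp (PolyTime.id.fst.pair ((𝓗.gen_polyTime.comp
      (PolyTime.id.fst.pair PolyTime.id.snd.fst)).pair (PolyTime.id.snd.snd.fst.pair
        (PolyTime.id.snd.snd.snd.pair (.const [])))))
  obtain ⟨p, hp⟩ := hpoly.polyBdd
  -- The argument of `p` bounds the size of the encoded coins: a bit takes up to four nodes.
  refine ⟨p.comp (2 * Polynomial.X + 4 * 𝓗.keyCoins + 4 * C.coins + 4 * A.coins + 7) + 1,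
    fun k x => ?_⟩
  have h1 := hp (k, List.ofFn x.1, List.ofFn x.2.1, List.ofFn x.2.2)
  have h2 := length_le_sz (A.envLedger C (k, 𝓗.key k x.1, List.ofFn x.2.1, List.ofFn x.2.2, []))
  have h3 := sz_bits_le (List.ofFn x.1)
  have h4 := sz_bits_le (List.ofFn x.2.1)
  have h5 := sz_bits_le (List.ofFn x.2.2)
  rw [List.length_ofFn] at h3 h4 h5
  rw [Polynomial.eval_add, Polynomial.eval_comp, Polynomial.eval_one]
  refine Nat.lt_succ_of_le (h2.trans (h1.trans (eval_mono p ?_)))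
  simp only [sz_pair, sz_nat, Polynomial.eval_add, Polynomial.eval_mul, Polynomial.eval_ofNat,
    Polynomial.eval_X]
  omega

/-- Coins of the experiment without those of the challenger, and the latter. -/
def sampleEquiv (A : Responder) (𝓗 : HashFamily) (C : Consensus) (tape : ℕ → ℕ) (bound k : ℕ) :
    Sample 𝓗 C A tape bound k ≃ A.BaseCoins 𝓗 C k × (Fin bound → Coins (tape k)) where
  toFun x := ((x.1, x.2.1, x.2.2.1), x.2.2.2)
  invFun y := (y.1.1, y.1.2.1, y.1.2.2, y.2)
  left_inv _ := rfl
  right_inv _ := rfl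

/-- Guessing correctly costs a factor that is exponential in the length of the guess, which is
logarithmic in the length of the ledger. -/
theorem prob_not_challengerWins_le (hsafe : C.Safe 𝓗) (hdistinct : C.DistinctTransactions 𝓗)
    (hCcomplete : C.Complete 𝓗) (hXcomplete : X.Complete 𝓗) (ν : ℕ) (tape : ℕ → ℕ) (bound : ℕ)
    {G : Polynomial ℕ} {k M : ℕ} (hM : ∀ x : A.BaseCoins 𝓗 C k,
      (A.envLedger C (k, 𝓗.key k x.1, List.ofFn x.2.1, List.ofFn x.2.2, [])).length < M)
    (hG : 8 * Nat.log 2 M + 5 ≤ G.eval k) :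
    prob (fun ω => ¬ ChallengerWins (experiment 𝓗 X C A tape bound k ω)) ≤
      (2 : ℝ) ^ (8 * Nat.log 2 M + 5) *
        ((prob (fun x : A.BaseCoins 𝓗 C k × Coins (G.eval k) => A.CollisionEvent 𝓗 X C (toEnv x)) +
          prob (fun x : A.BaseCoins 𝓗 C k × Coins (G.eval k) => A.ConsensusEvent C ν (toEnv x))) +
          prob (fun x : A.BaseCoins 𝓗 C k × Coins (G.eval k) => A.ExecutionEvent X C (toEnv x))) := by
  set m := 8 * Nat.log 2 M + 5
  let success : (Env → Prop) → A.BaseCoins 𝓗 C k → Prop := fun E x =>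
    ∃ γ : Bits, γ.length ≤ m ∧ ∀ g : Coins (G.eval k), γ <+: List.ofFn g → E (toEnv (x, g))
  have hsuccess : ∀ E : Env → Prop, prob (success E) ≤
      (2 : ℝ) ^ m * prob fun x : A.BaseCoins 𝓗 C k × Coins (G.eval k) => E (toEnv x) := fun E =>
    prob_exists_prefix_le hG fun x => E (toEnv x)
  have h1 : prob (fun ω => ¬ ChallengerWins (experiment 𝓗 X C A tape bound k ω)) ≤
      prob (fun x => (success (A.CollisionEvent 𝓗 X C) x ∨ success (A.ConsensusEvent C ν) x) ∨
        success (A.ExecutionEvent X C) x) := by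
    rw [← prob_comp_fst (A.sampleEquiv 𝓗 C tape bound k)]
    refine prob_mono fun ω hω => ?_
    obtain ⟨γ, hγ, h⟩ := exists_guess hsafe hdistinct hCcomplete hXcomplete ν hω
      (hM (ω.1, ω.2.1, ω.2.2.1))
    have key : ∀ E : Env → Prop, (∀ g, E (k, 𝓗.key k ω.1, List.ofFn ω.2.1, List.ofFn ω.2.2.1,
        γ ++ g)) → success E (A.sampleEquiv 𝓗 C tape bound k ω).1 := by
      refine fun E hE => ⟨γ, hγ, fun g hg => ?_⟩
      obtain ⟨g', hg'⟩ := hg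
      have := hE g'
      rwa [hg'] at this
    rcases h with h | h | h
    · exact .inl (.inl (key _ h))
    · exact .inl (.inr (key _ h))
    · exact .inr (key _ h)
  have h2 := prob_or_le (fun x => success (A.CollisionEvent 𝓗 X C) x ∨
    success (A.ConsensusEvent C ν) x) (success (A.ExecutionEvent X C))
  have h3 := prob_or_le (success (A.CollisionEvent 𝓗 X C)) (success (A.ConsensusEvent C ν))
  have h4 := hsuccess (A.CollisionEvent 𝓗 X C)
  have h5 := hsuccess (A.ConsensusEvent C ν)
  have h6 := hsuccess (A.ExecutionEvent X C)
  rw [mul_add, mul_add]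
  linarith

end Responder

end LightClient


theorem mainTheorem1
    (𝓗 : LightClient.HashFamily) (X : LightClient.ExecutionLayer) (C : LightClient.Consensus)
    (α u ν : ℕ)
    (hH : 𝓗.CollisionResistant)
    (hsafe : C.Safe 𝓗) (hdistinct : C.DistinctTransactions 𝓗)
    (hCcomplete : C.Complete 𝓗) (hCsound : C.Sound 𝓗 ν)
    (hXcomplete : X.Complete 𝓗) (hXsound : X.Sound 𝓗)
    (A : LightClient.Responder) (tape : ℕ → ℕ) :
    LightClient.Overwhelming fun k =>
      LightClient.prob fun ω : LightClient.Sample 𝓗 C A tape (α * (u + ν)) k =>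
        LightClient.ChallengerWins
          (LightClient.experiment 𝓗 X C A tape (α * (u + ν)) k ω) := by
  open LightClient Responder in
  obtain ⟨P, hP⟩ := exists_length_envLedger_lt A 𝓗 C
  -- The number of coins for the guess only has to be a polynomial that is at least its length.
  set G : Polynomial ℕ := 8 * P + 5 with hG
  refine Negligible.of_le_mul (((negligible_collisionEvent (A := A) (X := X) (C := C) hH G).add
    (negligible_consensusEvent (A := A) hCsound G)).add
    (negligible_executionEvent (A := A) (C := C) hXsound G)) (32 * P ^ 8) (fun k => ?_) fun k => ?_
  · rw [one_sub_prob]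
    exact prob_nonneg _
  · have hP0 : P.eval k ≠ 0 := Nat.ne_zero_of_lt (hP k default)
    have hmG : 8 * Nat.log 2 (P.eval k) + 5 ≤ G.eval k := by
      have := Nat.log_le_self 2 (P.eval k)
      simp only [hG, Polynomial.eval_add, Polynomial.eval_mul, Polynomial.eval_ofNat]
      omega
    -- As `2 ^ Nat.log 2 n ≤ n`, the cost of guessing is at most `2 ^ 5 * P ^ 8`.
    have hpow : (2 : ℝ) ^ (8 * Nat.log 2 (P.eval k) + 5) ≤
        ((32 * P ^ 8 : Polynomial ℕ).eval k : ℕ) := by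
      have h := Nat.pow_le_pow_left (Nat.pow_log_le_self 2 hP0) 8
      have : 2 ^ (8 * Nat.log 2 (P.eval k) + 5) ≤ (32 * P ^ 8 : Polynomial ℕ).eval k := by
        simp only [Polynomial.eval_mul, Polynomial.eval_pow, Polynomial.eval_ofNat]
        rw [pow_add, mul_comm 8, pow_mul]
        omega
      exact_mod_cast this
    rw [one_sub_prob]
    refine (prob_not_challengerWins_le hsafe hdistinct hCcomplete hXcomplete ν tape _ (hP k)
      hmG).trans (mul_le_mul_of_nonneg_right hpow ?_)
    exact add_nonneg (add_nonneg (prob_nonneg _) (prob_nonneg _)) (prob_nonneg _)
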